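/- **Model.** Let $N,T\in\mathbb N$ be the number of players and the horizon. Player $i\in[1,N]$ has state $x_t^i\in\mathbb R^{n_x^i}$, control $u_t^i\in\mathbb R^{n_u^i}$, dynamics $x_{t+1}^i=A_t^ix_t^i+B_t^iu_t^i+C_t^iy_t+w_t^i$, stage cost $c_t^i(x,u,y)=x'Q_t^ix+u'R_t^iu+2y'(K_t^iu+L_t^ix)$ and terminal cost $c_T^i(x)=x'Q_T^ix$, with $Q_t^i\succ0$ $(t\le T)$, $R_t^i\succ0$ $(t<T)$ symmetric, and discount factor $\beta^i\in[0,1]$. The environment variables $y_t\in\mathbb R^{n_y}$ are generated, with an environment state $x_t^0$, by $$x_{t+1}^0=A_t^0x_t^0+\sum_i(B_t^{1,i}u_t^i+B_t^{2,i}x_t^i)+w_t^0,\qquad y_t=D_tx_t^0+\sum_i(E_t^{1,i}u_t^i+E_t^{2,i}x_t^i)+\xi_t,\qquad t\in[0,T).$$ Put $X_t=(x_t^i)_{i\in[0,N]}$, $W_t=(w_t^i)_{i\in[0,N]}$, $Y_{t-1}=(y_k)_{k<t}$, $I_t^i=((x_k^i)_{k\le t},(u_k^i)_{k<t})$. A pure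 strategy of player $i$ is a family $s^i=(s_t^i)_{t<T}$ of measurable maps, $u_t^i=s_t^i(I_t^i,Y_{t-1})$. For a deterministic sequence $z=(z_t)_{t<T}$ let $$J^i(s^i,z)=E\Big[\sum_{t<T}(\beta^i)^tc_t^i(x_t^i,u_t^i,z_t)+(\beta^i)^Tc_T^i(x_T^i)\Big]\in(-\infty,\infty],$$ where $x^i$ and $u^i$ are generated by $s^i$ with $y$ replaced by $z$. A joint pure strategy $s=(s^1,\dots,s^N)$ is a *subjective equilibrium under beliefs of exogenous uncertainty (SEBEU) in pure strategies* if there are probability measures $\zeta^1,\dots,\zeta^N$ on $(\mathbb R^{n_y})^T$ such that, for every $i$: (i) $\int J^i(s^i,z)\,\zeta^i(dz)\le\int J^i(\tilde s^i,z)\,\zeta^i(dz)$ for every pure strategy $\tilde s^i$ (all these integrals being well defined in $[-\infty,\infty]$); (ii) $\zeta^i$ is the law of $(y_t)_{t<T}$ when all players use $s$. **Gains.** For each player (superscript $i$ dropped) let $M_T=Q_T$ and, for $k<T$, $S_k=R_k+\beta B_k'M_{k+1}B_k$, $M_k=Q_k+\beta A_k'(M_{k+1}-\beta M_{k+1}B_kS_k^{-1}B_k'M_{k+1})A_k$,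 $F_k=-\beta S_k^{-1}B_k'M_{k+1}A_k$, $\Phi_{k,k}=I$, $\Phi_{k,t}=\Phi_{k,t-1}\,\beta(A_t+B_tF_t)'$ for $t>k$, and $$G_{k,k}=-S_k^{-1}(K_k'+\beta B_k'M_{k+1}C_k),\qquad G_{k,t}=-\beta S_k^{-1}B_k'\big(\Phi_{k,t}M_{t+1}C_t+\Phi_{k,t-1}(F_t'K_t'+L_t')\big)\ (k<t<T),$$ $$H_k=-\beta S_k^{-1}B_k'\sum_{t=k}^{T-1}\Phi_{k,t}M_{t+1}E[w_t].$$ Let $\mathcal D_t,\mathcal G^p_{t,n},\mathcal H^p_t,\mathcal A_t,\mathcal G^X_{t,n},\mathcal H^X_t,\mathcal C_t$ be the coefficients for which substituting $u_t^i=F_t^ix_t^i+\sum_{n=t}^{T-1}G^i_{t,n}v_n+H_t^i$ $(i\in[1,N])$ into the system gives $$y_t=\mathcal D_tX_t+\sum_{n=t}^{T-1}\mathcal G^p_{t,n}v_n+\mathcal H^p_t+\xi_t,\qquad X_{t+1}=\mathcal A_tX_t+\sum_{n=t}^{T-1}\mathcal G^X_{t,n}v_n+\mathcal H^X_t+\mathcal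 C_ty_t+W_t.$$ For $k<T$ and $\hat X$, $Eq(k,\hat X)$ denotes the linear equations, with $\hat X_k=\hat X$ and unknowns $\hat y_t$, $t\in[k,T)$, $$\hat y_t=\mathcal D_t\hat X_t+\sum_{n=t}^{T-1}\mathcal G^p_{t,n}\hat y_n+\mathcal H^p_t+E[\xi_t],\qquad \hat X_{t+1}=\mathcal A_t\hat X_t+\sum_{n=t}^{T-1}\mathcal G^X_{t,n}\hat y_n+\mathcal H^X_t+\mathcal C_t\hat y_t+E[W_t],\qquad t\in[k,T).$$ **Theorem.** Assume that (1) $X_0,W_0,\dots,W_{T-1},\xi_0,\dots,\xi_{T-1}$ are mutually independent with finite second moments, and (2) $Eq(k,\hat X)$ has a unique solution for every $k\in[0,T)$ and every $\hat X$. Then the solutions have the form $\hat y_t=a_{t,k-1}\hat X+b_{t,k-1}$, $t\in[k,T)$, with matrices $a_{t,k-1}$ and vectors $b_{t,k-1}$ not depending on $\hat X$. Moreover, there is a process $(\bar X_t,\bar y_t)$ with $\bar X_0=X_0$ and, for $t<T$ almost surely, with $\bar Y_{t-1}=(\bar y_k)_{k<t}$, $$\bar y_t=\mathcal D_t\bar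 X_t+\sum_{n=t}^{T-1}\mathcal G^p_{t,n}\big(a_{n,t-1}E[\bar X_t\mid\bar Y_{t-1}]+b_{n,t-1}\big)+\mathcal H^p_t+\xi_t,$$ $$\bar X_{t+1}=\mathcal A_t\bar X_t+\sum_{n=t}^{T-1}\mathcal G^X_{t,n}\big(a_{n,t-1}E[\bar X_t\mid\bar Y_{t-1}]+b_{n,t-1}\big)+\mathcal H^X_t+\mathcal C_t\bar y_t+W_t,$$ and there are measurable maps $\hat{\bar X}_{t|t-1}$ with $\hat{\bar X}_{t|t-1}(\bar Y_{t-1})=E[\bar X_t\mid\bar Y_{t-1}]$ almost surely, $t<T$. For every such process and all such maps, $\bar X_t$ $(t\le T)$ and $\bar y_t$ $(t<T)$ have finite second moments, the joint strategy $$s_t^i(I_t^i,Y_{t-1})=F_t^ix_t^i+G_t^i\,\hat{\bar X}_{t|t-1}(Y_{t-1})+\check H_t^i,\qquad G_t^i=\sum_{k=t}^{T-1}G^i_{t,k}a_{k,t-1},\quad \check H_t^i=\sum_{k=t}^{T-1}G^i_{t,k}b_{k,t-1}+H_t^i,$$ is an SEBEU in pure strategies, and the law of $(y_t)_{t<T}$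 under $s$ (hence every player's belief) is the law of $(\bar y_t)_{t<T}$. -/

import Mathlib

open MeasureTheory ProbabilityTheory Finset
open scoped ENNReal Matrix

noncomputable section

/-- Real column vectors of size `n`. -/
abbrev RVec (n : ℕ) : Type := Fin n → ℝ

/-- The quadratic form `|x|_Q^2 = x' Q x`. -/
def quadForm {n : ℕ} (Q : Matrix (Fin n) (Fin n) ℝ) (x : RVec n) : ℝ := x ⬝ᵥ (Q *ᵥ x)

/-- Data of one decision maker, for horizon `T` and environment variables in `ℝ^ny`.
Time-indexed data is indexed by `ℕ`; only times `t < T` (`t ≤ T` for `Q`) are ever used. -/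
structure LQPlayer (T ny : ℕ) where
  nx : ℕ
  nu : ℕ
  A : ℕ → Matrix (Fin nx) (Fin nx) ℝ
  B : ℕ → Matrix (Fin nx) (Fin nu) ℝ
  C : ℕ → Matrix (Fin nx) (Fin ny) ℝ
  Q : ℕ → Matrix (Fin nx) (Fin nx) ℝ
  R : ℕ → Matrix (Fin nu) (Fin nu) ℝ
  K : ℕ → Matrix (Fin ny) (Fin nu) ℝ
  L : ℕ → Matrix (Fin ny) (Fin nx) ℝ
  β : ℝ
  Q_pos : ∀ t, t ≤ T → (Q t).PosDef
  R_pos : ∀ t, t < T → (R t).PosDef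
  β_nonneg : 0 ≤ β
  β_le_one : β ≤ 1

namespace LQPlayer

variable {T ny : ℕ} (p : LQPlayer T ny)

/-- The stage cost `c_t(x,u,y)`. -/
def stageCost (t : ℕ) (x : RVec p.nx) (u : RVec p.nu) (y : RVec ny) : ℝ :=
  quadForm (p.Q t) x + quadForm (p.R t) u + 2 * (y ⬝ᵥ (p.K t *ᵥ u + p.L t *ᵥ x))

/-- Private history `I_t = ((x_k)_{k ≤ t}, (u_k)_{k < t})`. -/
abbrev Info (t : ℕ) : Type := (Fin (t + 1) → RVec p.nx) × (Fin t → RVec p.nu)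

/-- A family of maps `s_t : (I_t, Y_{t-1}) ↦ u_t`. -/
abbrev Strategy : Type := ∀ t : ℕ, p.Info t × (Fin t → RVec ny) → RVec p.nu

/-- Pure strategies: `s_t` is measurable at every time `t < T`. -/
def IsPure (s : p.Strategy) : Prop := ∀ t, t < T → Measurable (s t)

/-- Private history when strategy `s` faces the environment sequence `z`, started at `x0` and with
disturbances `w`. -/
def privHist (s : p.Strategy) (z : ℕ → RVec ny) (x0 : RVec p.nx) (w : ℕ → RVec p.nx) :
    ∀ t : ℕ, p.Info t
  | 0 => (fun _ => x0, Fin.elim0)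
  | t + 1 =>
    let h := privHist s z x0 w t
    let x := h.1 (Fin.last t)
    let u := s t (h, fun k => z k)
    (Fin.snoc h.1 (p.A t *ᵥ x + p.B t *ᵥ u + p.C t *ᵥ z t + w t), Fin.snoc h.2 u)

/-- Total discounted cost of a complete history `I_T` against the environment sequence `z`. -/
def totalCost (h : p.Info T) (z : Fin T → RVec ny) : ℝ :=
  (∑ t : Fin T, p.β ^ (t : ℕ) * p.stageCost t (h.1 t.castSucc) (h.2 t) (z t))
    + p.β ^ T * quadForm (p.Q T) (h.1 (Fin.last T))

/-- `S_k` as a function of `M_{k+1}`. -/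
def gramS (k : ℕ) (M' : Matrix (Fin p.nx) (Fin p.nx) ℝ) : Matrix (Fin p.nu) (Fin p.nu) ℝ :=
  p.R k + p.β • ((p.B k)ᵀ * M' * p.B k)

/-- Riccati matrices: `M_T = Q_T` and
`M_k = Q_k + β A_k' (M_{k+1} - β M_{k+1} B_k S_k⁻¹ B_k' M_{k+1}) A_k` for `k < T`. -/
def riccati (k : ℕ) : Matrix (Fin p.nx) (Fin p.nx) ℝ :=
  if k < T then
    p.Q k + p.β • ((p.A k)ᵀ *
      (riccati (k + 1) - p.β • (riccati (k + 1) * p.B k * (p.gramS k (riccati (k + 1)))⁻¹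
        * (p.B k)ᵀ * riccati (k + 1))) * p.A k)
  else p.Q T
termination_by T - k

/-- `S_k = R_k + β B_k' M_{k+1} B_k`. -/
def S (k : ℕ) : Matrix (Fin p.nu) (Fin p.nu) ℝ := p.gramS k (p.riccati (k + 1))

/-- `F_k = -β S_k⁻¹ B_k' M_{k+1} A_k`. -/
def F (k : ℕ) : Matrix (Fin p.nu) (Fin p.nx) ℝ :=
  -(p.β • ((p.S k)⁻¹ * (p.B k)ᵀ * p.riccati (k + 1) * p.A k))

/-- `Φ_{k,t} = ∏_{n = k+1}^t β (A_n + B_n F_n)'`, factors ordered from left to right. -/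
def Phi (k : ℕ) : ℕ → Matrix (Fin p.nx) (Fin p.nx) ℝ
  | 0 => 1
  | t + 1 => if k < t + 1 then
      Phi k t * (p.β • (p.A (t + 1) + p.B (t + 1) * p.F (t + 1))ᵀ) else 1

/-- `G_{k,t}` for `k ≤ t < T`. -/
def G (k t : ℕ) : Matrix (Fin p.nu) (Fin ny) ℝ :=
  if t = k then
    -((p.S k)⁻¹ * ((p.K k)ᵀ + p.β • ((p.B k)ᵀ * p.riccati (k + 1) * p.C k)))
  else
    -(p.β • ((p.S k)⁻¹ * (p.B k)ᵀ * (p.Phi k t * p.riccati (t + 1) * p.C t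
      + p.Phi k (t - 1) * ((p.F t)ᵀ * (p.K t)ᵀ + (p.L t)ᵀ))))

/-- `H_k = -β S_k⁻¹ B_k' ∑_{t ∈ [k,T)} Φ_{k,t} M_{t+1} ŵ_t`, with `ŵ_t` the mean disturbance. -/
def H (wHat : ℕ → RVec p.nx) (k : ℕ) : RVec p.nu :=
  -(p.β • (((p.S k)⁻¹ * (p.B k)ᵀ) *ᵥ
    ∑ t ∈ Ico k T, (p.Phi k t * p.riccati (t + 1)) *ᵥ wHat t))

end LQPlayer

/-- Data of the finite-horizon linear-quadratic game. -/
structure LQGame where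
  N : ℕ
  T : ℕ
  ny : ℕ
  nx0 : ℕ
  player : Fin N → LQPlayer T ny
  A0 : ℕ → Matrix (Fin nx0) (Fin nx0) ℝ
  B1 : ℕ → ∀ i, Matrix (Fin nx0) (Fin (player i).nu) ℝ
  B2 : ℕ → ∀ i, Matrix (Fin nx0) (Fin (player i).nx) ℝ
  D : ℕ → Matrix (Fin ny) (Fin nx0) ℝ
  E1 : ℕ → ∀ i, Matrix (Fin ny) (Fin (player i).nu) ℝ
  E2 : ℕ → ∀ i, Matrix (Fin ny) (Fin (player i).nx) ℝ

/-- `E f ∈ [-∞, ∞]`: expectation of the positive part minus that of the negative part. -/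
def eexp {α : Type*} [MeasurableSpace α] (μ : Measure α) (f : α → EReal) : EReal :=
  ((∫⁻ a, (f a).toENNReal ∂μ : ℝ≥0∞) : EReal) - ((∫⁻ a, (-f a).toENNReal ∂μ : ℝ≥0∞) : EReal)

/-- `E f` is well defined in `[-∞, ∞]`: not of the form `∞ - ∞`. -/
def HasEExp {α : Type*} [MeasurableSpace α] (μ : Measure α) (f : α → EReal) : Prop :=
  ∫⁻ a, (f a).toENNReal ∂μ ≠ ⊤ ∨ ∫⁻ a, (-f a).toENNReal ∂μ ≠ ⊤

namespace LQGame

variable (g : LQGame)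

/-- Values of the environment variables. -/
abbrev Y : Type := RVec g.ny

/-- System states `X = (x^0, (x^i)_i)`. -/
abbrev State : Type := RVec g.nx0 × (∀ i, RVec (g.player i).nx)

/-- Joint strategies. -/
abbrev Joint : Type := ∀ i, (g.player i).Strategy

/-- Primitive random variables `X_0`, `W_t = (w_t^0, (w_t^i)_i)`, `ξ_t` (used for `t < T`). -/
structure Primitives (Ω : Type*) where
  X0 : Ω → g.State
  W : ℕ → Ω → g.State
  ξ : ℕ → Ω → g.Y

/-- Joint history `((X_k)_{k ≤ t}, (u_k)_{k < t}, (y_k)_{k < t})`. -/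
abbrev History (t : ℕ) : Type :=
  (Fin (t + 1) → g.State) × (Fin t → ∀ i, RVec (g.player i).nu) × (Fin t → g.Y)

variable {g}

/-- History generated endogenously by the joint strategy `s`, for given realizations of the
primitives. -/
def jointHist (s : g.Joint) (X0 : g.State) (W : ℕ → g.State) (ξ : ℕ → g.Y) :
    ∀ t : ℕ, g.History t
  | 0 => (fun _ => X0, Fin.elim0, Fin.elim0)
  | t + 1 =>
    let h := jointHist s X0 W ξ t
    let X := h.1 (Fin.last t)
    let u : ∀ i, RVec (g.player i).nu := fun i =>
      s i t ((fun k => (h.1 k).2 i, fun k => h.2.1 k i), h.2.2)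
    let y : g.Y := g.D t *ᵥ X.1 + ∑ i, (g.E1 t i *ᵥ u i + g.E2 t i *ᵥ X.2 i) + ξ t
    let X' : g.State :=
      (g.A0 t *ᵥ X.1 + ∑ i, (g.B1 t i *ᵥ u i + g.B2 t i *ᵥ X.2 i) + (W t).1,
       fun i => (g.player i).A t *ᵥ X.2 i + (g.player i).B t *ᵥ u i
        + (g.player i).C t *ᵥ y + (W t).2 i)
    (Fin.snoc h.1 X', Fin.snoc h.2.1 u, Fin.snoc h.2.2 y)

/-- Extension of a sequence on `[0,T)` to `ℕ`; the values at `t ≥ T` are never used. -/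
def extendY (z : Fin g.T → g.Y) (t : ℕ) : g.Y := if h : t < g.T then z ⟨t, h⟩ else 0

section Probability

variable {Ω : Type*} [MeasurableSpace Ω] (μ : Measure Ω) (P : g.Primitives Ω)

/-- Objective law `ζ_s` of the environment variables under `s`. -/
def envLaw (s : g.Joint) : Measure (Fin g.T → g.Y) :=
  μ.map fun ω => (jointHist s (P.X0 ω) (fun t => P.W t ω) (fun t => P.ξ t ω) g.T).2.2

/-- `J^i(s^i, z)`, the expected cost of player `i` against a deterministic environment sequence
`z`. For fixed `z` the cost is bounded below, so this is a well-defined element of `(-∞, ∞]`. -/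
def cost (i : Fin g.N) (si : (g.player i).Strategy) (z : Fin g.T → g.Y) : EReal :=
  eexp μ fun ω => (((g.player i).totalCost
    ((g.player i).privHist si (extendY z) ((P.X0 ω).2 i) (fun t => (P.W t ω).2 i) g.T) z : ℝ)
      : EReal)

/-- The strategy `si` minimizes `E^ζ[J^i(·, ·)]` over the pure strategies of player `i`, and this
objective is well defined for all of them. -/
def IsOptimal (i : Fin g.N) (ζ : Measure (Fin g.T → g.Y)) (si : (g.player i).Strategy) : Prop :=
  ∀ si' : (g.player i).Strategy, (g.player i).IsPure si' →
    HasEExp ζ (cost μ P i si') ∧ eexp ζ (cost μ P i si) ≤ eexp ζ (cost μ P i si')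

/-- Subjective equilibrium under beliefs of exogenous uncertainty, in pure strategies. -/
def IsSEBEU (s : g.Joint) : Prop :=
  (∀ i, (g.player i).IsPure (s i)) ∧
  ∃ ζ : Fin g.N → Measure (Fin g.T → g.Y),
    (∀ i, IsProbabilityMeasure (ζ i)) ∧
    (∀ i, IsOptimal μ P i (ζ i) (s i)) ∧
    (∀ i, ζ i = envLaw μ P s)

/-- The σ-algebras generated by `X_0`, by each `W_t` and by each `ξ_t`, `t < T`. -/
abbrev primSigma : Unit ⊕ (Fin g.T ⊕ Fin g.T) → MeasurableSpace Ω :=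
  Sum.elim (fun _ => MeasurableSpace.comap P.X0 inferInstance)
    (Sum.elim (fun t => MeasurableSpace.comap (P.W t) inferInstance)
      (fun t => MeasurableSpace.comap (P.ξ t) inferInstance))

/-- The primitives are random variables with finite second moments and are mutually independent. -/
structure IndepSecondMoments : Prop where
  meas_X0 : Measurable P.X0
  meas_W : ∀ t, t < g.T → Measurable (P.W t)
  meas_ξ : ∀ t, t < g.T → Measurable (P.ξ t)
  memLp_X0 : MemLp P.X0 2 μ
  memLp_W : ∀ t, t < g.T → MemLp (P.W t) 2 μ
  memLp_ξ : ∀ t, t < g.T → MemLp (P.ξ t) 2 μ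
  indep : iIndep (primSigma P) μ

/-- `Ŵ_t = E[W_t]`. -/
def WHat (t : ℕ) : g.State := ∫ ω, P.W t ω ∂μ

/-- `ξ̂_t = E[ξ_t]`. -/
def ξHat (t : ℕ) : g.Y := ∫ ω, P.ξ t ω ∂μ

/-- The constant `H_t^i` of player `i`. -/
def Hi (i : Fin g.N) (t : ℕ) : RVec (g.player i).nu :=
  (g.player i).H (fun k => (WHat μ P k).2 i) t

/-! Coefficients of the vector form of the closed-loop system. -/

variable (g) in
/-- `𝒟_t X`. -/
def cD (t : ℕ) (X : g.State) : g.Y :=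
  g.D t *ᵥ X.1 + ∑ j, ((g.E1 t j * (g.player j).F t) *ᵥ X.2 j + g.E2 t j *ᵥ X.2 j)

variable (g) in
/-- `𝒢^p_{t,n} y`. -/
def cGp (t n : ℕ) (y : g.Y) : g.Y := ∑ j, (g.E1 t j * (g.player j).G t n) *ᵥ y

/-- `ℋ^p_t`. -/
def cHp (t : ℕ) : g.Y := ∑ j, g.E1 t j *ᵥ Hi μ P j t

variable (g) in
/-- `𝒜_t X`. -/
def cA (t : ℕ) (X : g.State) : g.State :=
  (g.A0 t *ᵥ X.1 + ∑ j, ((g.B1 t j * (g.player j).F t) *ᵥ X.2 j + g.B2 t j *ᵥ X.2 j),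
   fun j => (g.player j).A t *ᵥ X.2 j + ((g.player j).B t * (g.player j).F t) *ᵥ X.2 j)

variable (g) in
/-- `𝒢^X_{t,n} y`. -/
def cGX (t n : ℕ) (y : g.Y) : g.State :=
  (∑ j, (g.B1 t j * (g.player j).G t n) *ᵥ y,
   fun j => ((g.player j).B t * (g.player j).G t n) *ᵥ y)

/-- `ℋ^X_t`. -/
def cHX (t : ℕ) : g.State :=
  (∑ j, g.B1 t j *ᵥ Hi μ P j t, fun j => (g.player j).B t *ᵥ Hi μ P j t)

variable (g) in
/-- `𝒞_t y`. -/
def cC (t : ℕ) (y : g.Y) : g.State := (0, fun j => (g.player j).C t *ᵥ y)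

/-- The linear equations `Eq(k, X̂)` in the unknowns `ŷ_t`, `t ∈ [k,T)` (with the auxiliary
`X̂_t`, `t ∈ [k,T]`, started at `X̂`). -/
def EqSys (k : ℕ) (Xk : g.State) (yh : ℕ → g.Y) (Xh : ℕ → g.State) : Prop :=
  Xh k = Xk ∧ ∀ t, k ≤ t → t < g.T →
    yh t = cD g t (Xh t) + ∑ n ∈ Ico t g.T, cGp g t n (yh n) + cHp μ P t + ξHat μ P t ∧
    Xh (t + 1) = cA g t (Xh t) + ∑ n ∈ Ico t g.T, cGX g t n (yh n) + cHX μ P t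
      + cC g t (yh t) + WHat μ P t

/-- `Eq(k, X̂)` has a unique solution for every `k < T` and every `X̂`. -/
def UniquelySolvable : Prop :=
  ∀ k, k < g.T → ∀ Xk : g.State,
    (∃ yh Xh, EqSys μ P k Xk yh Xh) ∧
    ∀ yh Xh yh' Xh', EqSys μ P k Xk yh Xh → EqSys μ P k Xk yh' Xh' →
      ∀ t, k ≤ t → t < g.T → yh t = yh' t

/-- `ŷ_t = a_{t,k-1} X̂ + b_{t,k-1}` solves `Eq(k, X̂)`, for every `k < T` and every `X̂`.
Here `a t k` and `b t k` stand for `a_{t,k-1}` and `b_{t,k-1}`. -/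
def IsAffineSolution (a : ℕ → ℕ → (g.State →ₗ[ℝ] g.Y)) (b : ℕ → ℕ → g.Y) : Prop :=
  ∀ k, k < g.T → ∀ Xk : g.State, ∃ Xh, EqSys μ P k Xk (fun t => a t k Xk + b t k) Xh

/-- `Ȳ_{t-1} = (ȳ_k)_{k < t}`. -/
def past (ybar : ℕ → Ω → g.Y) (t : ℕ) (ω : Ω) : Fin t → g.Y := fun k => ybar k ω

/-- `E[X̄_t | Ȳ_{t-1}]`. -/
def condMean (Xbar : ℕ → Ω → g.State) (ybar : ℕ → Ω → g.Y) (t : ℕ) : Ω → g.State :=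
  μ[Xbar t | MeasurableSpace.comap (past ybar t) inferInstance]

/-- The replica environment process `(X̄, ȳ)`, driven by `X_0`, `W`, `ξ`. -/
structure IsReplica (a : ℕ → ℕ → (g.State →ₗ[ℝ] g.Y)) (b : ℕ → ℕ → g.Y)
    (Xbar : ℕ → Ω → g.State) (ybar : ℕ → Ω → g.Y) : Prop where
  meas_X : ∀ t, t ≤ g.T → Measurable (Xbar t)
  meas_y : ∀ t, t < g.T → Measurable (ybar t)
  init : Xbar 0 = P.X0
  output : ∀ t, t < g.T → ∀ᵐ ω ∂μ,
    ybar t ω = cD g t (Xbar t ω)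
      + ∑ n ∈ Ico t g.T, cGp g t n (a n t (condMean μ Xbar ybar t ω) + b n t)
      + cHp μ P t + P.ξ t ω
  step : ∀ t, t < g.T → ∀ᵐ ω ∂μ,
    Xbar (t + 1) ω = cA g t (Xbar t ω)
      + ∑ n ∈ Ico t g.T, cGX g t n (a n t (condMean μ Xbar ybar t ω) + b n t)
      + cHX μ P t + cC g t (ybar t ω) + P.W t ω

/-- `est t` is a measurable state estimator mapping `Ȳ_{t-1}` to `E[X̄_t | Ȳ_{t-1}]`. -/
def IsEstimator (Xbar : ℕ → Ω → g.State) (ybar : ℕ → Ω → g.Y)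
    (est : ∀ t : ℕ, (Fin t → g.Y) → g.State) : Prop :=
  ∀ t, t < g.T → Measurable (est t) ∧
    (fun ω => est t (past ybar t ω)) =ᵐ[μ] condMean μ Xbar ybar t

/-- `G_t^i = ∑_{k ∈ [t,T)} G_{t,k}^i a_{k,t-1}`. -/
def gainG (a : ℕ → ℕ → (g.State →ₗ[ℝ] g.Y)) (i : Fin g.N) (t : ℕ) :
    g.State →ₗ[ℝ] RVec (g.player i).nu :=
  ∑ k ∈ Ico t g.T, ((g.player i).G t k).mulVecLin ∘ₗ a k t

/-- `Ȟ_t^i = ∑_{k ∈ [t,T)} G_{t,k}^i b_{k,t-1} + H_t^i`. -/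
def offsetH (b : ℕ → ℕ → g.Y) (i : Fin g.N) (t : ℕ) : RVec (g.player i).nu :=
  ∑ k ∈ Ico t g.T, (g.player i).G t k *ᵥ b k t + Hi μ P i t

/-- The joint strategy `s_t^i(I_t^i, Y_{t-1}) = F_t^i x_t^i + G_t^i est_t(Y_{t-1}) + Ȟ_t^i`. -/
def affineStrategy (a : ℕ → ℕ → (g.State →ₗ[ℝ] g.Y)) (b : ℕ → ℕ → g.Y)
    (est : ∀ t : ℕ, (Fin t → g.Y) → g.State) : g.Joint :=
  fun i t info => (g.player i).F t *ᵥ info.1.1 (Fin.last t) + gainG a i t (est t info.2)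
    + offsetH μ P b i t

end Probability

end LQGame

end

/-! Under a belief of exogenous uncertainty a player faces a convex linear-quadratic control problem
in which the environment sequence `z` is independent of the player's own initial state and noise:
expected cost is an integral over `ζ.prod μ`. Completing squares gives a function `slack` of `z`
alone for which cost plus slack is nonnegative and bounds the controls; since it is integrable and
independent of the strategy, comparing expected costs reduces to comparing integrals of nonnegative
functions. Certainty equivalence is proved by first-order conditions instead of dynamic programming.
By convexity the cost of a deviation exceeds the original cost by at least a sum of discounted
products of a `gradient` with the change in control (`pathCost_add_gradient_le`). If the predictions
have errors orthogonal to past information, backward induction through the Riccati recursion shows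
that the gradient at time `t` is orthogonal to the information available at `t`
(`orthTo_costate_and_gradient`). A deviating control is a function of that information, and it is
square integrable if its cost is finite and its discount factor is positive, so the first-order
terms integrate to zero (`lintegral_shiftedCost_le`). It remains to find predictions that are
correct in equilibrium. Unique solvability makes the solutions of `EqSys` affine in the initial
state and consistent from one time to the next (`IsAffineSolution.exists_next`). Evaluated at the
conditional mean of the replica state they therefore predict the replica outputs
(`IsReplica.orthTo_prediction`). When the players compute their controls from these predictions, the
actual system obeys the replica equations, hence coincides with the replica almost surely
(`IsReplica.ae_eq_joint`), and the law of the replica outputs is a self-confirming belief. -/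

noncomputable section

/-! ### Orthogonality to information, the L² form of zero conditional mean. -/

section Orthogonality

variable {Λ D D₂ E F : Type*} [MeasurableSpace Λ] [MeasurableSpace D] [MeasurableSpace D₂]
  [NormedAddCommGroup E] [NormedSpace ℝ E] [NormedAddCommGroup F] [NormedSpace ℝ F]

/-- `e` is square integrable and orthogonal to every square integrable function of `π`. -/
structure OrthTo (μ : Measure Λ) (π : Λ → D) (e : Λ → E) : Prop where
  memLp : MemLp e 2 μ
  integral_smul_eq_zero : ∀ ψ : D → ℝ, Measurable ψ → MemLp (fun ω => ψ (π ω)) 2 μ →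
    ∫ ω, ψ (π ω) • e ω ∂μ = 0

namespace OrthTo

variable {μ : Measure Λ} {π π' : Λ → D} {e f : Λ → E}

theorem zero : OrthTo μ π (fun _ => (0 : E)) :=
  ⟨MemLp.zero', fun ψ _ _ => by simp⟩

theorem integrable_smul {φ : Λ → ℝ} (hφ : MemLp φ 2 μ) (he : MemLp e 2 μ) :
    Integrable (fun ω => φ ω • e ω) μ :=
  memLp_one_iff_integrable.1 (he.smul hφ)

theorem add (he : OrthTo μ π e) (hf : OrthTo μ π f) : OrthTo μ π (fun ω => e ω + f ω) where
  memLp := he.memLp.add hf.memLp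
  integral_smul_eq_zero ψ hψ hL := by
    simp only [smul_add]
    rw [integral_add (integrable_smul hL he.memLp) (integrable_smul hL hf.memLp),
      he.integral_smul_eq_zero ψ hψ hL, hf.integral_smul_eq_zero ψ hψ hL, add_zero]

theorem clm [CompleteSpace E] [CompleteSpace F] (he : OrthTo μ π e) (A : E →L[ℝ] F) :
    OrthTo μ π (fun ω => A (e ω)) where
  memLp := A.comp_memLp' he.memLp
  integral_smul_eq_zero ψ hψ hL := by
    have := A.integral_comp_comm (integrable_smul hL he.memLp)
    simp only [map_smul] at this
    rw [this, he.integral_smul_eq_zero ψ hψ hL, map_zero]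

theorem linear [FiniteDimensional ℝ E] [CompleteSpace F] (he : OrthTo μ π e)
    (A : E →ₗ[ℝ] F) : OrthTo μ π (fun ω => A (e ω)) := by
  have := FiniteDimensional.complete ℝ E
  exact he.clm A.toContinuousLinearMap

theorem neg [CompleteSpace E] (he : OrthTo μ π e) : OrthTo μ π (fun ω => -e ω) :=
  he.clm (-ContinuousLinearMap.id ℝ E)

theorem sub [CompleteSpace E] (he : OrthTo μ π e) (hf : OrthTo μ π f) :
    OrthTo μ π (fun ω => e ω - f ω) := by
  simpa only [sub_eq_add_neg] using he.add hf.neg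

theorem smul [CompleteSpace E] (he : OrthTo μ π e) (c : ℝ) : OrthTo μ π (fun ω => c • e ω) :=
  he.clm (c • ContinuousLinearMap.id ℝ E)

theorem congr (he : OrthTo μ π e) (h : ∀ᵐ ω ∂μ, f ω = e ω) : OrthTo μ π f where
  memLp := (memLp_congr_ae h).2 he.memLp
  integral_smul_eq_zero ψ hψ hL := by
    rw [← he.integral_smul_eq_zero ψ hψ hL]
    exact integral_congr_ae (h.mono fun ω hω => by simp only [hω])

theorem congr_left (he : OrthTo μ π e) (h : ∀ᵐ ω ∂μ, π' ω = π ω) : OrthTo μ π' e where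
  memLp := he.memLp
  integral_smul_eq_zero ψ hψ hL := by
    have h' : (fun ω => ψ (π' ω)) =ᵐ[μ] fun ω => ψ (π ω) := h.mono fun ω hω => by simp only [hω]
    rw [← he.integral_smul_eq_zero ψ hψ ((memLp_congr_ae h').1 hL)]
    exact integral_congr_ae (h'.mono fun ω hω => by simp only [hω])

/-- Passing to coarser information; this plays the role of the tower property. -/
theorem comp {ρ : D → D₂} (hρ : Measurable ρ) (he : OrthTo μ π e) :
    OrthTo μ (fun ω => ρ (π ω)) e where
  memLp := he.memLp
  integral_smul_eq_zero ψ hψ hL := he.integral_smul_eq_zero (fun d => ψ (ρ d)) (hψ.comp hρ) hL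

theorem of_indepFun [IsProbabilityMeasure μ] [MeasurableSpace E] [BorelSpace E]
    [SecondCountableTopology E] [CompleteSpace E] (hπ : Measurable π) (hm : Measurable f)
    (hf : MemLp f 2 μ) (h : IndepFun π f μ) : OrthTo μ π (fun ω => f ω - ∫ ω', f ω' ∂μ) where
  memLp := hf.sub (memLp_const _)
  integral_smul_eq_zero ψ hψ hL := by
    have key := h.integral_fun_comp_smul_comp (f := ψ) (g := fun x => x - ∫ ω', f ω' ∂μ)
      hπ.aemeasurable hm.aemeasurable hψ.aestronglyMeasurable
      (measurable_id.sub_const _).aestronglyMeasurable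
    rw [key, integral_sub (hf.integrable one_le_two) (integrable_const _)]
    simp

/-- The pull-out property: `ψ ∘ π` is measurable for the σ-algebra generated by `π`, so it can be
moved out of the conditional expectation before integrating. -/
theorem sub_condExp [IsProbabilityMeasure μ] [CompleteSpace E] (hπ : Measurable π)
    (hf : MemLp f 2 μ) :
    OrthTo μ π (fun ω => f ω - (μ[f | MeasurableSpace.comap π inferInstance]) ω) where
  memLp := hf.sub (hf.condExp one_le_two)
  integral_smul_eq_zero ψ hψ hL := by
    have hm := hπ.comap_le
    have hc := hf.condExp (m := MeasurableSpace.comap π inferInstance) one_le_two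
    have hψm : StronglyMeasurable[MeasurableSpace.comap π inferInstance] (fun ω => ψ (π ω)) :=
      (hψ.comp (comap_measurable π)).stronglyMeasurable
    have hi := integrable_smul hL hf
    have pull := condExp_smul_of_aestronglyMeasurable_left (μ := μ)
      hψm.aestronglyMeasurable hi (hf.integrable one_le_two)
    simp only [smul_sub]
    rw [integral_sub hi (integrable_smul hL hc), ← integral_condExp hm, sub_eq_zero]
    exact integral_congr_ae pull

end OrthTo

end Orthogonality

/-! ### Extended expectations of differences of nonnegative functions. -/

section ExtendedExpectation

variable {α : Type*} [MeasurableSpace α] {μ : Measure α}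

theorem toENNReal_coe_sub_coe (a b : ℝ≥0∞) :
    ((a : EReal) - (b : EReal)).toENNReal = a - b := by
  rw [EReal.toENNReal_sub (EReal.coe_ennreal_nonneg b)]
  simp

/-- Finiteness of `b` is needed: in `EReal`, `⊤ - ⊤ = ⊥`, whose negative is `⊤`, while `⊤ - ⊤ = 0`
in `ℝ≥0∞`. -/
theorem toENNReal_neg_coe_sub_coe (a : ℝ≥0∞) {b : ℝ≥0∞} (hb : b ≠ ⊤) :
    (-((a : EReal) - (b : EReal))).toENNReal = b - a := by
  rw [EReal.neg_sub (Or.inr (by simp)) (Or.inr (by simpa using hb)), add_comm, ← sub_eq_add_neg,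
    toENNReal_coe_sub_coe]

variable {H C : α → ℝ≥0∞}

theorem hasEExp_sub (hC : ∀ a, C a ≠ ⊤) (hCi : ∫⁻ a, C a ∂μ ≠ ⊤) :
    HasEExp μ (fun a => (H a : EReal) - (C a : EReal)) := by
  refine Or.inr (ne_top_of_le_ne_top hCi (lintegral_mono fun a => ?_))
  rw [toENNReal_neg_coe_sub_coe _ (hC a)]
  exact tsub_le_self

theorem eexp_sub (hH : Measurable H) (hCm : Measurable C) (hC : ∀ a, C a ≠ ⊤)
    (hCi : ∫⁻ a, C a ∂μ ≠ ⊤) :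
    eexp μ (fun a => (H a : EReal) - (C a : EReal))
      = ((∫⁻ a, H a ∂μ : ℝ≥0∞) : EReal) - ((∫⁻ a, C a ∂μ : ℝ≥0∞) : EReal) := by
  have hb : ∫⁻ a, (C a - H a) ∂μ ≠ ⊤ :=
    ne_top_of_le_ne_top hCi (lintegral_mono fun a => tsub_le_self)
  -- With truncated subtraction both integrands equal `max H C`. The integrals of `C` and `C - H`
  -- are finite, so the identity can be rearranged in the reals, or else both other integrals are
  -- infinite.
  have key : ∫⁻ a, (H a - C a) ∂μ + ∫⁻ a, C a ∂μ = ∫⁻ a, H a ∂μ + ∫⁻ a, (C a - H a) ∂μ := by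
    rw [← lintegral_add_right _ hCm, ← lintegral_add_left hH]
    refine lintegral_congr fun a => ?_
    rw [tsub_add_eq_max, add_tsub_eq_max]
  simp only [eexp, toENNReal_coe_sub_coe, toENNReal_neg_coe_sub_coe _ (hC _)]
  generalize ∫⁻ a, (H a - C a) ∂μ = p at *
  generalize ∫⁻ a, (C a - H a) ∂μ = q at *
  generalize ∫⁻ a, H a ∂μ = h at *
  generalize ∫⁻ a, C a ∂μ = c at *
  lift c to NNReal using hCi
  lift q to NNReal using hb
  by_cases hh : h = ⊤
  · subst hh
    have : p = ⊤ := by simpa using key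
    subst this
    simp
  · have hp : p ≠ ⊤ := by
      rintro rfl
      simp at key
      exact hh ((ENNReal.add_eq_top.1 key.symm).resolve_right ENNReal.coe_ne_top)
    lift h to NNReal using hh
    lift p to NNReal using hp
    have key' : (p : ℝ) + c = h + q := by exact_mod_cast key
    have : (p : ℝ) - q = h - c := by linarith
    simp only [EReal.coe_nnreal_eq_coe_real]
    exact_mod_cast this

end ExtendedExpectation

/-! ### Completing the square for positive definite forms. -/

section QuadraticForms

variable {n : ℕ} {Q : Matrix (Fin n) (Fin n) ℝ}

theorem quadForm_nonneg (hQ : Q.PosSemidef) (x : RVec n) : 0 ≤ quadForm Q x := by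
  simpa [quadForm] using hQ.dotProduct_mulVec_nonneg x

theorem transpose_eq_of_isHermitian (hQ : Q.IsHermitian) : Qᵀ = Q := by
  simpa [Matrix.IsHermitian, Matrix.conjTranspose_eq_transpose_of_trivial] using hQ

theorem quadForm_add (hQ : Q.IsHermitian) (x d : RVec n) :
    quadForm Q (x + d) = quadForm Q x + 2 * ((Q *ᵥ x) ⬝ᵥ d) + quadForm Q d := by
  have h : x ⬝ᵥ (Q *ᵥ d) = (Q *ᵥ x) ⬝ᵥ d := by
    rw [Matrix.dotProduct_mulVec, ← Matrix.mulVec_transpose, transpose_eq_of_isHermitian hQ]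
  simp only [quadForm, Matrix.mulVec_add, add_dotProduct, dotProduct_add, h]
  rw [dotProduct_comm d (Q *ᵥ x)]
  ring

theorem quadForm_smul (c : ℝ) (x : RVec n) : quadForm Q (c • x) = c ^ 2 * quadForm Q x := by
  simp only [quadForm, Matrix.mulVec_smul, smul_dotProduct, dotProduct_smul, smul_eq_mul]
  ring

theorem mulVec_inv_mulVec (hQ : Q.PosDef) (x : RVec n) : Q *ᵥ (Q⁻¹ *ᵥ x) = x := by
  rw [Matrix.mulVec_mulVec, Matrix.mul_nonsing_inv _ ((Matrix.isUnit_iff_isUnit_det _).1 hQ.isUnit),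
    Matrix.one_mulVec]

/-- The right-hand side is the square `quadForm Q (Q⁻¹ *ᵥ k + x)`. -/
theorem quadForm_add_linear_nonneg (hQ : Q.PosDef) (k x : RVec n) :
    0 ≤ quadForm Q x + 2 * (k ⬝ᵥ x) + quadForm Q (Q⁻¹ *ᵥ k) := by
  have h := quadForm_nonneg hQ.posSemidef (Q⁻¹ *ᵥ k + x)
  rw [quadForm_add hQ.1, mulVec_inv_mulVec hQ] at h
  linarith

/-- Completing the square with `2k` in place of `k` and halving leaves half of the quadratic term to
spare. -/
theorem half_quadForm_le (hQ : Q.PosDef) (k x : RVec n) :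
    quadForm Q x / 2 ≤ quadForm Q x + 2 * (k ⬝ᵥ x) + 2 * quadForm Q (Q⁻¹ *ᵥ k) := by
  have h := quadForm_add_linear_nonneg hQ ((2 : ℝ) • k) x
  rw [Matrix.mulVec_smul, quadForm_smul, smul_dotProduct, smul_eq_mul] at h
  linarith

theorem exists_sq_le_quadForm (hQ : Q.PosDef) (j : Fin n) :
    ∃ c, 0 < c ∧ ∀ x : RVec n, x j ^ 2 ≤ c * quadForm Q x := by
  set q := quadForm Q (Q⁻¹ *ᵥ Pi.single j 1) with hq
  have hq0 : 0 ≤ q := quadForm_nonneg hQ.posSemidef _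
  refine ⟨q + 1, by linarith, fun x => ?_⟩
  -- With `s = x j / (q + 1)` this reads `s² (q + 2) ≤ quadForm Q x`, while `x j ^ 2 = s² (q + 1)²`.
  -- Using `q + 1` instead of `q` avoids having to show `q > 0`.
  have h := quadForm_add_linear_nonneg hQ ((-(x j / (q + 1))) • Pi.single j (1 : ℝ)) x
  rw [Matrix.mulVec_smul, quadForm_smul, smul_dotProduct, smul_eq_mul, ← hq,
    single_dotProduct, one_mul] at h
  have hp : (0 : ℝ) < q + 1 := by linarith
  set s := x j / (q + 1) with hs
  have hx : x j = s * (q + 1) := by rw [hs]; field_simp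
  rw [hx] at h ⊢
  nlinarith [sq_nonneg s]

end QuadraticForms

/-! ### Riccati recursion and the affine part of the certainty equivalent control. -/

namespace LQPlayer

variable {T ny : ℕ} (p : LQPlayer T ny)

theorem riccati_of_lt {k : ℕ} (hk : k < T) :
    p.riccati k = p.Q k + p.β • ((p.A k)ᵀ *
      (p.riccati (k + 1) - p.β • (p.riccati (k + 1) * p.B k * (p.S k)⁻¹
        * (p.B k)ᵀ * p.riccati (k + 1))) * p.A k) := by
  rw [riccati, if_pos hk]
  rfl

theorem riccati_of_le {k : ℕ} (hk : T ≤ k) : p.riccati k = p.Q T := by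
  rw [riccati, if_neg (not_lt.2 hk)]

theorem posDef_S {k : ℕ} (hk : k < T) (hM : (p.riccati (k + 1)).PosSemidef) : (p.S k).PosDef := by
  refine (p.R_pos k hk).add_posSemidef (Matrix.PosSemidef.smul ?_ p.β_nonneg)
  simpa [Matrix.conjTranspose_eq_transpose_of_trivial] using
    hM.conjTranspose_mul_mul_same (p.B k)

theorem S_mul_F {k : ℕ} (hS : (p.S k).PosDef) :
    p.S k * p.F k = -(p.β • ((p.B k)ᵀ * p.riccati (k + 1) * p.A k)) := by
  have hu := (Matrix.isUnit_iff_isUnit_det _).1 hS.isUnit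
  rw [F, Matrix.mul_neg, Matrix.mul_smul]
  simp only [← Matrix.mul_assoc, Matrix.mul_nonsing_inv _ hu, Matrix.one_mul]

theorem riccati_eq_add_F {k : ℕ} (hk : k < T) :
    p.riccati k = p.Q k
      + p.β • ((p.A k)ᵀ * p.riccati (k + 1) * (p.A k + p.B k * p.F k)) := by
  rw [riccati_of_lt p hk, F]
  simp only [Matrix.mul_sub, Matrix.sub_mul, Matrix.mul_add, Matrix.mul_neg, Matrix.mul_smul,
    Matrix.smul_mul, ← Matrix.mul_assoc]
  rw [sub_eq_add_neg]

theorem F_transpose_mul_S {k : ℕ} (hS : (p.S k).PosDef) (hM : (p.riccati (k + 1)).PosSemidef) :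
    (p.F k)ᵀ * p.S k = -(p.β • ((p.A k)ᵀ * p.riccati (k + 1) * p.B k)) := by
  have h := congrArg Matrix.transpose (p.S_mul_F hS)
  simpa [Matrix.transpose_mul, transpose_eq_of_isHermitian hS.1,
    transpose_eq_of_isHermitian hM.1, ← Matrix.mul_assoc] using h

/-- This form displays the Riccati matrix as a sum of positive semidefinite terms. It differs from
`riccati_eq_add_F` by `F' (S F + β B' M A)`, which vanishes by `S_mul_F`. -/
theorem riccati_eq_quadratic {k : ℕ} (hk : k < T) (hM : (p.riccati (k + 1)).PosSemidef) :
    p.riccati k = p.Q k + ((p.F k)ᵀ * p.R k * p.F k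
      + p.β • ((p.A k + p.B k * p.F k)ᵀ * p.riccati (k + 1) * (p.A k + p.B k * p.F k))) := by
  have hS := p.posDef_S hk hM
  have h : (p.F k)ᵀ * (p.S k * p.F k)
      + p.β • ((p.F k)ᵀ * ((p.B k)ᵀ * p.riccati (k + 1) * p.A k)) = 0 := by
    rw [p.S_mul_F hS, Matrix.mul_neg, Matrix.mul_smul]
    simp
  rw [show p.S k = p.R k + p.β • ((p.B k)ᵀ * p.riccati (k + 1) * p.B k) from rfl] at h
  rw [riccati_eq_add_F p hk]
  simp only [Matrix.mul_add, Matrix.add_mul, Matrix.mul_smul, Matrix.smul_mul,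
    Matrix.transpose_add, Matrix.transpose_mul, ← Matrix.mul_assoc, smul_add] at h ⊢
  congr 1
  rw [← sub_eq_zero, ← neg_eq_zero, ← h]
  abel

theorem posSemidef_riccati {k : ℕ} (hk : k ≤ T) : (p.riccati k).PosSemidef := by
  induction hk using Nat.decreasingInduction with
  | self => rw [p.riccati_of_le le_rfl]; exact (p.Q_pos T le_rfl).posSemidef
  | of_succ k hk ih =>
    rw [p.riccati_eq_quadratic hk ih]
    refine (p.Q_pos k hk.le).posSemidef.add (Matrix.PosSemidef.add ?_ (Matrix.PosSemidef.smul ?_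
      p.β_nonneg))
    · simpa [Matrix.conjTranspose_eq_transpose_of_trivial] using
        (p.R_pos k hk).posSemidef.conjTranspose_mul_mul_same (p.F k)
    · simpa only [Matrix.conjTranspose_eq_transpose_of_trivial] using
        ih.conjTranspose_mul_mul_same (p.A k + p.B k * p.F k)

theorem posDef_S_of_lt {k : ℕ} (hk : k < T) : (p.S k).PosDef :=
  p.posDef_S hk (p.posSemidef_riccati hk)

/-- The one-step factor `β (A_k + B_k F_k)'` of `Φ`. -/
def Psi (k : ℕ) : Matrix (Fin p.nx) (Fin p.nx) ℝ := p.β • (p.A k + p.B k * p.F k)ᵀ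

theorem Phi_self (k : ℕ) : p.Phi k k = 1 := by
  cases k <;> simp [Phi]

theorem Phi_succ {k t : ℕ} (h : k ≤ t) : p.Phi k (t + 1) = p.Phi k t * p.Psi (t + 1) := by
  rw [Phi, if_pos (Nat.lt_succ_of_le h), Psi]

/-- `Phi` grows on the right as `t` increases; backward recursions need the leftmost factor split
off. -/
theorem Phi_eq_Psi_mul {k t : ℕ} (h : k + 1 ≤ t) : p.Phi k t = p.Psi (k + 1) * p.Phi (k + 1) t := by
  induction t, h using Nat.le_induction with
  | base => rw [Phi_succ p le_rfl, Phi_self, Phi_self, Matrix.one_mul, Matrix.mul_one]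
  | succ t h ih => rw [Phi_succ p (by lia), ih, Phi_succ p h, Matrix.mul_assoc]

/-- The part of the predicted costate at time `k` which is due to the predicted environment
variables `v` and mean disturbances `wHat` from time `k` on. -/
def affineTail (wHat : ℕ → RVec p.nx) (v : ℕ → RVec ny) (k : ℕ) : RVec p.nx :=
  if k < T then
    ((p.F k)ᵀ * (p.K k)ᵀ + (p.L k)ᵀ) *ᵥ v k
      + p.Psi k *ᵥ (p.riccati (k + 1) *ᵥ (p.C k *ᵥ v k + wHat k) + affineTail wHat v (k + 1))
  else 0
termination_by T - k

theorem affineTail_of_lt (wHat : ℕ → RVec p.nx) (v : ℕ → RVec ny) {k : ℕ} (hk : k < T) :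
    p.affineTail wHat v k = ((p.F k)ᵀ * (p.K k)ᵀ + (p.L k)ᵀ) *ᵥ v k
      + p.Psi k *ᵥ (p.riccati (k + 1) *ᵥ (p.C k *ᵥ v k + wHat k)
        + p.affineTail wHat v (k + 1)) := by
  rw [affineTail, if_pos hk]

theorem affineTail_of_le (wHat : ℕ → RVec p.nx) (v : ℕ → RVec ny) {k : ℕ} (hk : T ≤ k) :
    p.affineTail wHat v k = 0 := by
  rw [affineTail, if_neg (not_lt.2 hk)]

/-- Unrolls the backward recursion, in order to match it with the gains `G` and `H`. The terms in
`K` and `L` at time `n` carry `Phi k (n - 1)` because they enter the costate at `n` directly,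
whereas the terms in `riccati (n + 1)` pass through `Psi n` as well. -/
theorem affineTail_closed_form (wHat : ℕ → RVec p.nx) (v : ℕ → RVec ny) {k : ℕ} (hk : k < T) :
    p.riccati (k + 1) *ᵥ (p.C k *ᵥ v k + wHat k) + p.affineTail wHat v (k + 1)
      = ∑ n ∈ Ico k T, p.Phi k n *ᵥ (p.riccati (n + 1) *ᵥ (p.C n *ᵥ v n + wHat n))
        + ∑ n ∈ Ico (k + 1) T,
          p.Phi k (n - 1) *ᵥ (((p.F n)ᵀ * (p.K n)ᵀ + (p.L n)ᵀ) *ᵥ v n) := by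
  induction h : T - k generalizing k with
  | zero => lia
  | succ m ih =>
    rw [sum_eq_sum_Ico_succ_bot hk, Phi_self, Matrix.one_mulVec, add_assoc]
    congr 1
    rcases Nat.lt_or_ge (k + 1) T with h1 | h1
    · have e1 : ∑ n ∈ Ico (k + 1) T, p.Phi k n *ᵥ (p.riccati (n + 1) *ᵥ (p.C n *ᵥ v n + wHat n))
          = p.Psi (k + 1) *ᵥ ∑ n ∈ Ico (k + 1) T,
            p.Phi (k + 1) n *ᵥ (p.riccati (n + 1) *ᵥ (p.C n *ᵥ v n + wHat n)) := by
        rw [Matrix.mulVec_sum]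
        refine sum_congr rfl fun n hn => ?_
        rw [p.Phi_eq_Psi_mul (mem_Ico.1 hn).1, Matrix.mulVec_mulVec (M := p.Psi (k + 1))]
      have e2 : ∑ n ∈ Ico (k + 1 + 1) T,
          p.Phi k (n - 1) *ᵥ (((p.F n)ᵀ * (p.K n)ᵀ + (p.L n)ᵀ) *ᵥ v n)
          = p.Psi (k + 1) *ᵥ ∑ n ∈ Ico (k + 1 + 1) T,
            p.Phi (k + 1) (n - 1) *ᵥ (((p.F n)ᵀ * (p.K n)ᵀ + (p.L n)ᵀ) *ᵥ v n) := by
        rw [Matrix.mulVec_sum]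
        refine sum_congr rfl fun n hn => ?_
        have := (mem_Ico.1 hn).1
        rw [p.Phi_eq_Psi_mul (by lia), Matrix.mulVec_mulVec (M := p.Psi (k + 1))]
      rw [p.affineTail_of_lt _ _ h1, ih h1 (by lia), e1,
        sum_eq_sum_Ico_succ_bot h1 (fun n => p.Phi k (n - 1) *ᵥ _), e2, Nat.add_sub_cancel,
        Phi_self, Matrix.one_mulVec, Matrix.mulVec_add]
      abel
    · rw [p.affineTail_of_le _ _ h1, Ico_eq_empty (by lia)]
      simp

/-- The affine part of the certainty equivalent control solves the stationarity equation. -/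
theorem S_mulVec_affine (wHat : ℕ → RVec p.nx) (v : ℕ → RVec ny) {k : ℕ} (hk : k < T) :
    p.S k *ᵥ (∑ n ∈ Ico k T, p.G k n *ᵥ v n + p.H wHat k)
      = -((p.K k)ᵀ *ᵥ v k + p.β • ((p.B k)ᵀ *ᵥ
        (p.riccati (k + 1) *ᵥ (p.C k *ᵥ v k + wHat k) + p.affineTail wHat v (k + 1)))) := by
  have hS := p.posDef_S_of_lt hk
  have key : ∑ n ∈ Ico k T, p.G k n *ᵥ v n + p.H wHat k
      = (p.S k)⁻¹ *ᵥ -((p.K k)ᵀ *ᵥ v k + p.β • ((p.B k)ᵀ *ᵥ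
        (p.riccati (k + 1) *ᵥ (p.C k *ᵥ v k + wHat k) + p.affineTail wHat v (k + 1)))) := by
    have hG : ∑ n ∈ Ico (k + 1) T, p.G k n *ᵥ v n
        = ∑ n ∈ Ico (k + 1) T, (p.S k)⁻¹ *ᵥ -(p.β • ((p.B k)ᵀ *ᵥ
          (p.Phi k n *ᵥ (p.riccati (n + 1) *ᵥ (p.C n *ᵥ v n))
            + p.Phi k (n - 1) *ᵥ (((p.F n)ᵀ * (p.K n)ᵀ + (p.L n)ᵀ) *ᵥ v n)))) := by
      refine sum_congr rfl fun n hn => ?_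
      have := (mem_Ico.1 hn).1
      rw [G, if_neg (by lia)]
      simp only [Matrix.neg_mulVec, Matrix.smul_mulVec, Matrix.mulVec_neg, Matrix.mulVec_smul,
        Matrix.mulVec_add, Matrix.add_mulVec, Matrix.mulVec_mulVec, Matrix.mul_add,
        Matrix.mul_assoc]
    rw [p.affineTail_closed_form _ _ hk, sum_eq_sum_Ico_succ_bot hk, hG, H,
      ← Matrix.mulVec_sum, G, if_pos rfl]
    simp only [Matrix.neg_mulVec, Matrix.smul_mulVec, Matrix.mulVec_neg, Matrix.mulVec_smul,
        Matrix.mulVec_add, Matrix.add_mulVec, Matrix.mulVec_mulVec, Matrix.mul_add,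
        Matrix.mul_smul, Matrix.mul_assoc, sum_neg_distrib, ← smul_sum, sum_add_distrib,
        Matrix.mulVec_sum]
    simp only [sum_eq_sum_Ico_succ_bot hk, Phi_self, Matrix.one_mul, smul_add]
    abel
  rw [key, mulVec_inv_mulVec hS]

end LQPlayer

/-! ### Costates, first-order bounds and stationarity. -/

namespace LQPlayer

variable {T ny : ℕ} (p : LQPlayer T ny)

/-- The costate of a trajectory `x` facing the environment sequence `z`. -/
def costate (x : ℕ → RVec p.nx) (z : ℕ → RVec ny) (k : ℕ) : RVec p.nx :=
  if k < T then p.Q k *ᵥ x k + (p.L k)ᵀ *ᵥ z k + p.β • ((p.A k)ᵀ *ᵥ costate x z (k + 1))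
  else p.Q T *ᵥ x T
termination_by T - k

theorem costate_of_lt (x : ℕ → RVec p.nx) (z : ℕ → RVec ny) {k : ℕ} (hk : k < T) :
    p.costate x z k
      = p.Q k *ᵥ x k + (p.L k)ᵀ *ᵥ z k + p.β • ((p.A k)ᵀ *ᵥ p.costate x z (k + 1)) := by
  rw [costate, if_pos hk]

theorem costate_self (x : ℕ → RVec p.nx) (z : ℕ → RVec ny) :
    p.costate x z T = p.Q T *ᵥ x T := by
  rw [costate, if_neg (lt_irrefl _)]

/-- Half the derivative of the cost with respect to the control at time `k`. -/
def gradient (x : ℕ → RVec p.nx) (u : ℕ → RVec p.nu) (z : ℕ → RVec ny) (k : ℕ) : RVec p.nu :=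
  p.R k *ᵥ u k + (p.K k)ᵀ *ᵥ z k + p.β • ((p.B k)ᵀ *ᵥ p.costate x z (k + 1))

/-- Discounted cost of the trajectory `(x, u)` against the environment sequence `z`. -/
def pathCost (x : ℕ → RVec p.nx) (u : ℕ → RVec p.nu) (z : ℕ → RVec ny) : ℝ :=
  ∑ t ∈ range T, p.β ^ t * p.stageCost t (x t) (u t) (z t) + p.β ^ T * quadForm (p.Q T) (x T)

/-- Convexity: the discarded terms are the quadratic forms of `d` and `e`. -/
theorem stageCost_add_le {t : ℕ} (ht : t < T) (x d : RVec p.nx) (u e : RVec p.nu) (z : RVec ny) :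
    p.stageCost t x u z + 2 * ((p.Q t *ᵥ x + (p.L t)ᵀ *ᵥ z) ⬝ᵥ d
      + (p.R t *ᵥ u + (p.K t)ᵀ *ᵥ z) ⬝ᵥ e) ≤ p.stageCost t (x + d) (u + e) z := by
  have hQ := p.Q_pos t ht.le
  have hR := p.R_pos t ht
  have hd := quadForm_nonneg hQ.posSemidef d
  have he := quadForm_nonneg hR.posSemidef e
  have hK : ((p.K t)ᵀ *ᵥ z) ⬝ᵥ e = z ⬝ᵥ (p.K t *ᵥ e) := by
    rw [Matrix.mulVec_transpose, Matrix.dotProduct_mulVec]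
  have hL : ((p.L t)ᵀ *ᵥ z) ⬝ᵥ d = z ⬝ᵥ (p.L t *ᵥ d) := by
    rw [Matrix.mulVec_transpose, Matrix.dotProduct_mulVec]
  simp only [stageCost, quadForm_add hQ.1, quadForm_add hR.1, add_dotProduct, dotProduct_add,
    Matrix.mulVec_add, hK, hL]
  linarith

/-- First-order lower bound for the cost of a deviation. -/
theorem pathCost_add_gradient_le {x x' : ℕ → RVec p.nx} {u u' : ℕ → RVec p.nu}
    (z : ℕ → RVec ny) (h0 : x 0 = x' 0)
    (hs : ∀ t, t < T → x' (t + 1) - x (t + 1)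
      = p.A t *ᵥ (x' t - x t) + p.B t *ᵥ (u' t - u t)) :
    p.pathCost x u z + 2 * ∑ t ∈ range T, p.β ^ t * (p.gradient x u z t ⬝ᵥ (u' t - u t))
      ≤ p.pathCost x' u' z := by
  have hT := p.Q_pos T le_rfl
  have term : p.β ^ T * (quadForm (p.Q T) (x T) + 2 * (p.costate x z T ⬝ᵥ (x' T - x T)))
      ≤ p.β ^ T * quadForm (p.Q T) (x' T) := by
    refine mul_le_mul_of_nonneg_left ?_ (pow_nonneg p.β_nonneg T)
    have h := quadForm_add hT.1 (x T) (x' T - x T)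
    rw [add_sub_cancel] at h
    rw [costate_self]
    linarith [quadForm_nonneg hT.posSemidef (x' T - x T)]
  -- The costate acts as a multiplier for the dynamics: it turns the state derivative of the stage
  -- cost into a telescoping difference plus the gradient term.
  have stage : ∀ t ∈ range T, p.β ^ t * p.stageCost t (x t) (u t) (z t)
      + 2 * (p.β ^ t * (p.costate x z t ⬝ᵥ (x' t - x t))
        - p.β ^ (t + 1) * (p.costate x z (t + 1) ⬝ᵥ (x' (t + 1) - x (t + 1))))
      + 2 * (p.β ^ t * (p.gradient x u z t ⬝ᵥ (u' t - u t)))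
      ≤ p.β ^ t * p.stageCost t (x' t) (u' t) (z t) := by
    intro t ht
    have ht := mem_range.1 ht
    have h := mul_le_mul_of_nonneg_left
      (p.stageCost_add_le ht (x t) (x' t - x t) (u t) (u' t - u t) (z t))
      (pow_nonneg p.β_nonneg t)
    rw [add_sub_cancel, add_sub_cancel] at h
    refine le_trans (le_of_eq ?_) h
    have hA : ((p.A t)ᵀ *ᵥ p.costate x z (t + 1)) ⬝ᵥ (x' t - x t)
        = p.costate x z (t + 1) ⬝ᵥ (p.A t *ᵥ (x' t - x t)) := by
      rw [Matrix.mulVec_transpose, Matrix.dotProduct_mulVec]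
    have hB : ((p.B t)ᵀ *ᵥ p.costate x z (t + 1)) ⬝ᵥ (u' t - u t)
        = p.costate x z (t + 1) ⬝ᵥ (p.B t *ᵥ (u' t - u t)) := by
      rw [Matrix.mulVec_transpose, Matrix.dotProduct_mulVec]
    rw [hs t ht, p.costate_of_lt x z ht, gradient]
    simp only [add_dotProduct _ _ (x' t - x t), add_dotProduct _ _ (u' t - u t),
      dotProduct_add (p.costate x z (t + 1)), smul_dotProduct, hA, hB, smul_eq_mul, pow_succ]
    ring
  have h := sum_le_sum stage
  simp only [sum_add_distrib, ← mul_sum] at h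
  -- The boundary term at `0` vanishes because the initial states agree; the one at `T` is absorbed
  -- by `term`.
  rw [sum_range_sub' (fun t => p.β ^ t * (p.costate x z t ⬝ᵥ (x' t - x t)))] at h
  simp only [h0, sub_self, dotProduct_zero, mul_zero, zero_sub] at h
  simp only [pathCost]
  linarith

/-- A nonnegative function of the environment sequence which makes the cost nonnegative. -/
def slack (z : ℕ → RVec ny) : ℝ :=
  ∑ t ∈ range T, p.β ^ t * (2 * quadForm (p.Q t) ((p.Q t)⁻¹ *ᵥ ((p.L t)ᵀ *ᵥ z t))
    + 2 * quadForm (p.R t) ((p.R t)⁻¹ *ᵥ ((p.K t)ᵀ *ᵥ z t)))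

theorem slack_nonneg (z : ℕ → RVec ny) : 0 ≤ p.slack z := by
  refine sum_nonneg fun t ht => mul_nonneg (pow_nonneg p.β_nonneg t) ?_
  have ht := mem_range.1 ht
  have h1 := quadForm_nonneg (p.Q_pos t ht.le).posSemidef ((p.Q t)⁻¹ *ᵥ ((p.L t)ᵀ *ᵥ z t))
  have h2 := quadForm_nonneg (p.R_pos t ht).posSemidef ((p.R t)⁻¹ *ᵥ ((p.K t)ᵀ *ᵥ z t))
  linarith

/-- Coercivity: the slack dominates the cross terms and still leaves half of the control cost, which
later makes the controls of finite-cost deviations square integrable. -/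
theorem sum_quadForm_le_pathCost_add_slack (x : ℕ → RVec p.nx) (u : ℕ → RVec p.nu)
    (z : ℕ → RVec ny) :
    ∑ t ∈ range T, p.β ^ t * (quadForm (p.R t) (u t) / 2) ≤ p.pathCost x u z + p.slack z := by
  have hT := mul_nonneg (pow_nonneg p.β_nonneg T)
    (quadForm_nonneg (p.Q_pos T le_rfl).posSemidef (x T))
  have h : ∀ t ∈ range T, p.β ^ t * (quadForm (p.R t) (u t) / 2)
      ≤ p.β ^ t * p.stageCost t (x t) (u t) (z t)
        + p.β ^ t * (2 * quadForm (p.Q t) ((p.Q t)⁻¹ *ᵥ ((p.L t)ᵀ *ᵥ z t))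
          + 2 * quadForm (p.R t) ((p.R t)⁻¹ *ᵥ ((p.K t)ᵀ *ᵥ z t))) := by
    intro t ht
    have ht := mem_range.1 ht
    rw [← mul_add]
    refine mul_le_mul_of_nonneg_left ?_ (pow_nonneg p.β_nonneg t)
    have hx := half_quadForm_le (p.Q_pos t ht.le) ((p.L t)ᵀ *ᵥ z t) (x t)
    have hu := half_quadForm_le (p.R_pos t ht) ((p.K t)ᵀ *ᵥ z t) (u t)
    have h0 := quadForm_nonneg (p.Q_pos t ht.le).posSemidef (x t)
    rw [Matrix.mulVec_transpose, ← Matrix.dotProduct_mulVec] at hx hu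
    simp only [stageCost, dotProduct_add, Matrix.mulVec_transpose] at hx hu ⊢
    linarith
  have h' := sum_le_sum h
  rw [sum_add_distrib] at h'
  simp only [pathCost, slack]
  linarith

theorem pathCost_add_slack_nonneg (x : ℕ → RVec p.nx) (u : ℕ → RVec p.nu) (z : ℕ → RVec ny) :
    0 ≤ p.pathCost x u z + p.slack z :=
  (sum_nonneg fun t ht => mul_nonneg (pow_nonneg p.β_nonneg t) (div_nonneg
    (quadForm_nonneg (p.R_pos t (mem_range.1 ht)).posSemidef _) zero_le_two)).trans
    (p.sum_quadForm_le_pathCost_add_slack x u z)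

theorem quadForm_control_le (x : ℕ → RVec p.nx) (u : ℕ → RVec p.nu) (z : ℕ → RVec ny)
    {t : ℕ} (ht : t < T) :
    p.β ^ t * quadForm (p.R t) (u t) ≤ 2 * (p.pathCost x u z + p.slack z) := by
  have h := single_le_sum (f := fun t => p.β ^ t * (quadForm (p.R t) (u t) / 2))
    (fun t ht => mul_nonneg (pow_nonneg p.β_nonneg t) (div_nonneg
      (quadForm_nonneg (p.R_pos t (mem_range.1 ht)).posSemidef _) zero_le_two)) (mem_range.2 ht)
  have h' := h.trans (p.sum_quadForm_le_pathCost_add_slack x u z)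
  linarith

section Stationarity

variable {Λ : Type*} [MeasurableSpace Λ] {μ : Measure Λ} {D : ℕ → Type*}
  [∀ t, MeasurableSpace (D t)] {π : ∀ t, Λ → D t}
  {x w : ℕ → Λ → RVec p.nx} {u : ℕ → Λ → RVec p.nu} {z : ℕ → Λ → RVec ny}
  {zhat : ℕ → ℕ → Λ → RVec ny} {wHat : ℕ → RVec p.nx}

theorem _root_.OrthTo.mulVec {D : Type*} [MeasurableSpace D] {π : Λ → D} {m n : ℕ}
    {e : Λ → RVec n} (h : OrthTo μ π e) (A : Matrix (Fin m) (Fin n) ℝ) :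
    OrthTo μ π (fun ω => A *ᵥ e ω) :=
  h.linear A.mulVecLin

/-- The tail is affine in the predictions, so a difference of tails is linear in the differences of
predictions. -/
theorem orthTo_affineTail_sub {D : Type*} [MeasurableSpace D] {π : Λ → D}
    {v v' : ℕ → Λ → RVec ny} {k : ℕ}
    (h : ∀ n, k ≤ n → n < T → OrthTo μ π (fun ω => v n ω - v' n ω)) :
    OrthTo μ π (fun ω => p.affineTail wHat (fun n => v n ω) k
      - p.affineTail wHat (fun n => v' n ω) k) := by
  induction hm : T - k generalizing k with
  | zero =>
    simp only [p.affineTail_of_le _ _ (show T ≤ k by lia), sub_self]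
    exact .zero
  | succ m ih =>
    have hk : k < T := by lia
    have ih := ih (k := k + 1) (fun n hn => h n (by lia)) (by lia)
    have hv := h k le_rfl hk
    refine ((hv.mulVec ((p.F k)ᵀ * (p.K k)ᵀ + (p.L k)ᵀ)).add ((((hv.mulVec (p.C k)).mulVec
      (p.riccati (k + 1))).add ih).mulVec (p.Psi k))).congr (.of_forall fun ω => ?_)
    simp only [p.affineTail_of_lt _ _ hk, Matrix.mulVec_add, Matrix.mulVec_sub]
    abel

/-- Under the certainty equivalent control the gradient is orthogonal to the information. -/
theorem orthTo_costate_and_gradient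
    (hπ : ∀ t, t + 1 < T → ∃ ρ : D (t + 1) → D t, Measurable ρ ∧ ∀ ω, π t ω = ρ (π (t + 1) ω))
    (hz : ∀ n t, t ≤ n → n < T → OrthTo μ (π t) (fun ω => z n ω - zhat n t ω))
    (hw : ∀ t, t < T → OrthTo μ (π t) (fun ω => w t ω - wHat t))
    (hx : ∀ t, t < T → ∀ ω, x (t + 1) ω
      = p.A t *ᵥ x t ω + p.B t *ᵥ u t ω + p.C t *ᵥ z t ω + w t ω)
    (hu : ∀ t, t < T → ∀ ω, u t ω
      = p.F t *ᵥ x t ω + (∑ n ∈ Ico t T, p.G t n *ᵥ zhat n t ω + p.H wHat t))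
    {t : ℕ} (ht : t < T) :
    OrthTo μ (π t) (fun ω => p.costate (fun k => x k ω) (fun k => z k ω) t
      - (p.riccati t *ᵥ x t ω + p.affineTail wHat (fun n => zhat n t ω) t)) ∧
    OrthTo μ (π t) (fun ω => p.gradient (fun k => x k ω) (fun k => u k ω) (fun k => z k ω) t) := by
  induction hm : T - t generalizing t with
  | zero => lia
  | succ m ih =>
    have hM := p.posSemidef_riccati (show t + 1 ≤ T from ht)
    have hS := p.posDef_S_of_lt ht
    -- The induction hypothesis at `t + 1` uses predictions made at `t + 1`; here they are replaced
    -- by those made at `t`.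
    have next : OrthTo μ (π t) (fun ω => p.costate (fun k => x k ω) (fun k => z k ω) (t + 1)
        - (p.riccati (t + 1) *ᵥ x (t + 1) ω
          + p.affineTail wHat (fun n => zhat n t ω) (t + 1))) := by
      rcases Nat.lt_or_ge (t + 1) T with h1 | h1
      · obtain ⟨ρ, hρ, hρπ⟩ := hπ t h1
        have down : ∀ {E : Type} [NormedAddCommGroup E] [NormedSpace ℝ E] {e : Λ → E},
            OrthTo μ (π (t + 1)) e → OrthTo μ (π t) e := fun he =>
          (he.comp hρ).congr_left (.of_forall hρπ)
        -- A revision of a prediction is a difference of two prediction errors, both orthogonal to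
        -- the coarser information at `t`.
        have hd : ∀ n, t + 1 ≤ n → n < T →
            OrthTo μ (π t) (fun ω => zhat n (t + 1) ω - zhat n t ω) := fun n hn hnT =>
          ((hz n t (by lia) hnT).sub (down (hz n (t + 1) hn hnT))).congr
            (.of_forall fun ω => by abel)
        exact ((down (ih h1 (by lia)).1).add (p.orthTo_affineTail_sub (wHat := wHat) hd)).congr
          (.of_forall fun ω => by abel)
      · obtain rfl : T = t + 1 := by lia
        refine OrthTo.zero.congr (.of_forall fun ω => ?_)
        rw [p.costate_self, p.riccati_of_le le_rfl, p.affineTail_of_le _ _ le_rfl]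
        simp
    have hzt := hz t t le_rfl ht
    set y : Λ → RVec p.nx := fun ω => p.riccati (t + 1) *ᵥ (p.C t *ᵥ zhat t t ω + wHat t)
      + p.affineTail wHat (fun n => zhat n t ω) (t + 1) with hy
    set f : Λ → RVec p.nu := fun ω => ∑ n ∈ Ico t T, p.G t n *ᵥ zhat n t ω + p.H wHat t with hf
    have hSf : ∀ ω, p.S t *ᵥ f ω = -((p.K t)ᵀ *ᵥ zhat t t ω + p.β • ((p.B t)ᵀ *ᵥ y ω)) :=
      fun ω => p.S_mulVec_affine wHat (fun n => zhat n t ω) ht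
    have hut : ∀ ω, u t ω = p.F t *ᵥ x t ω + f ω := hu t ht
    -- The error `e` collects the costate error at `t + 1` and the effect of replacing `z t` and `w
    -- t` by their predictions in the dynamics.
    obtain ⟨e, he, hcost⟩ : ∃ e : Λ → RVec p.nx, OrthTo μ (π t) e ∧
        ∀ ω, p.costate (fun k => x k ω) (fun k => z k ω) (t + 1) = e ω
          + (p.riccati (t + 1) *ᵥ (p.A t *ᵥ x t ω + p.B t *ᵥ (p.F t *ᵥ x t ω + f ω)) + y ω) := by
      refine ⟨_, next.add (((hzt.mulVec (p.C t)).add (hw t ht)).mulVec (p.riccati (t + 1))),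
        fun ω => ?_⟩
      rw [hx t ht ω, hut]
      simp only [hy, Matrix.mulVec_add, Matrix.mulVec_sub]
      abel
    constructor
    · refine ((hzt.mulVec (p.L t)ᵀ).add ((he.mulVec (p.A t)ᵀ).smul p.β)).congr
        (.of_forall fun ω => ?_)
      -- Computing `F' S f` in two ways, through `F' S` and through `S f`, turns `β A' M B f` into
      -- the terms of `affineTail` that involve `F'`.
      have hFS : (p.F t)ᵀ *ᵥ (p.S t *ᵥ f ω)
          = -(p.β • ((p.A t)ᵀ *ᵥ (p.riccati (t + 1) *ᵥ (p.B t *ᵥ f ω)))) := by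
        rw [Matrix.mulVec_mulVec, p.F_transpose_mul_S hS hM]
        simp only [Matrix.neg_mulVec, Matrix.smul_mulVec, Matrix.mulVec_mulVec, Matrix.mul_assoc]
      rw [hSf] at hFS
      have hMx : p.riccati t *ᵥ x t ω = p.Q t *ᵥ x t ω + p.β • ((p.A t)ᵀ *ᵥ (p.riccati (t + 1) *ᵥ
          (p.A t *ᵥ x t ω + p.B t *ᵥ (p.F t *ᵥ x t ω)))) := by
        rw [p.riccati_eq_add_F ht]
        simp only [Matrix.add_mulVec, Matrix.smul_mulVec, Matrix.mulVec_mulVec, Matrix.mul_assoc,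
          Matrix.mulVec_add, Matrix.mul_add]
      rw [p.costate_of_lt _ _ ht, hcost, hMx, p.affineTail_of_lt _ _ ht]
      change _ - (_ + ((_ : RVec p.nx) + p.Psi t *ᵥ y ω)) = _
      rw [Psi]
      have hFS' := sub_eq_zero.2 hFS
      rw [← sub_eq_zero, ← hFS']
      simp only [Matrix.mulVec_add, Matrix.mulVec_sub, Matrix.add_mulVec, Matrix.smul_mulVec,
        Matrix.transpose_add, Matrix.transpose_mul, Matrix.mulVec_neg, Matrix.mulVec_smul,
        ← Matrix.mulVec_mulVec, smul_add]
      module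
    · refine ((hzt.mulVec (p.K t)ᵀ).add ((he.mulVec (p.B t)ᵀ).smul p.β)).congr
        (.of_forall fun ω => ?_)
      have hSF : p.S t *ᵥ (p.F t *ᵥ x t ω)
          = -(p.β • ((p.B t)ᵀ *ᵥ (p.riccati (t + 1) *ᵥ (p.A t *ᵥ x t ω)))) := by
        rw [Matrix.mulVec_mulVec, p.S_mul_F hS]
        simp only [Matrix.neg_mulVec, Matrix.smul_mulVec, Matrix.mulVec_mulVec, Matrix.mul_assoc]
      have hSv : ∀ v, p.S t *ᵥ v
          = p.R t *ᵥ v + p.β • ((p.B t)ᵀ *ᵥ (p.riccati (t + 1) *ᵥ (p.B t *ᵥ v))) := by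
        intro v
        rw [S, gramS]
        simp only [Matrix.add_mulVec, Matrix.smul_mulVec, Matrix.mulVec_mulVec, Matrix.mul_assoc]
      -- The sum of the stationarity equations for the feedback and affine parts cancels everything
      -- in the gradient except the orthogonal error.
      have hsum := sub_eq_zero.2 (congrArg₂ (· + ·) hSF (hSf ω))
      rw [gradient, hcost, hut]
      rw [← sub_eq_zero, ← hsum]
      simp only [hSv, Matrix.mulVec_add, Matrix.mulVec_sub, smul_add]
      module

end Stationarity

end LQPlayer

/-! ### Measurability, integrability and orthogonality on product spaces. -/

/-- Extension of a finite sequence by zero. -/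
def extendZero {E : Type*} [Zero E] {t : ℕ} (v : Fin t → E) (k : ℕ) : E :=
  if h : k < t then v ⟨k, h⟩ else 0

theorem extendZero_of_lt {E : Type*} [Zero E] {t : ℕ} (v : Fin t → E) {k : ℕ} (h : k < t) :
    extendZero v k = v ⟨k, h⟩ := dif_pos h

theorem measurable_extendZero {E : Type*} [Zero E] [MeasurableSpace E] {t : ℕ} (k : ℕ) :
    Measurable (fun v : Fin t → E => extendZero v k) := by
  by_cases h : k < t
  · simpa only [extendZero, dif_pos h] using measurable_pi_apply _
  · simpa only [extendZero, dif_neg h] using measurable_const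

theorem measurable_finSnoc {Λ E : Type*} [MeasurableSpace Λ] [MeasurableSpace E] {t : ℕ}
    {f : Λ → Fin t → E} {a : Λ → E} (hf : Measurable f) (ha : Measurable a) :
    Measurable (fun ω => (Fin.snoc (f ω) (a ω) : Fin (t + 1) → E)) := by
  refine measurable_pi_lambda _ fun k => ?_
  refine Fin.lastCases ?_ (fun j => ?_) k
  · simpa only [Fin.snoc_last] using ha
  · simp only [Fin.snoc_castSucc]
    exact (measurable_pi_apply j).comp hf

theorem measurable_mulVec {m n : ℕ} (A : Matrix (Fin m) (Fin n) ℝ) :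
    Measurable (fun x : RVec n => A *ᵥ x) :=
  (continuous_const.matrix_mulVec continuous_id).measurable

theorem measurable_quadForm {n : ℕ} (Q : Matrix (Fin n) (Fin n) ℝ) : Measurable (quadForm Q) :=
  (continuous_id.dotProduct (continuous_const.matrix_mulVec continuous_id)).measurable

theorem MeasureTheory.MemLp.mulVec {Λ : Type*} [MeasurableSpace Λ] {μ : Measure Λ} {m n : ℕ}
    {f : Λ → RVec n} (hf : MemLp f 2 μ) (A : Matrix (Fin m) (Fin n) ℝ) :
    MemLp (fun ω => A *ᵥ f ω) 2 μ :=
  A.mulVecLin.toContinuousLinearMap.comp_memLp' hf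

theorem integrable_dotProduct {Λ : Type*} [MeasurableSpace Λ] {μ : Measure Λ} {n : ℕ}
    {f h : Λ → RVec n} (hf : MemLp f 2 μ) (hh : MemLp h 2 μ) :
    Integrable (fun ω => f ω ⬝ᵥ h ω) μ :=
  integrable_finsetSum _ fun i _ => (hf.eval i).integrable_mul (hh.eval i)

theorem integrable_quadForm {Λ : Type*} [MeasurableSpace Λ] {μ : Measure Λ} {n : ℕ}
    {f : Λ → RVec n} (hf : MemLp f 2 μ) (Q : Matrix (Fin n) (Fin n) ℝ) :
    Integrable (fun ω => quadForm Q (f ω)) μ :=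
  integrable_dotProduct hf (hf.mulVec Q)

section Product

variable {Λ₁ Λ₂ D₁ D₂ E : Type*} [MeasurableSpace Λ₁] [MeasurableSpace Λ₂] [MeasurableSpace D₁]
  [MeasurableSpace D₂] [NormedAddCommGroup E] [NormedSpace ℝ E]
  {μ₁ : Measure Λ₁} {μ₂ : Measure Λ₂} [IsProbabilityMeasure μ₁] [IsProbabilityMeasure μ₂]
  {π₁ : Λ₁ → D₁} {π₂ : Λ₂ → D₂}

/-- Fubini: with the second coordinate frozen, the test function depends on `π₁` alone and is square
integrable for almost every value of that coordinate. Independent extra information is thus useless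
for predicting `e`. -/
theorem OrthTo.prod_fst {e : Λ₁ → E} (he : OrthTo μ₁ π₁ e) (h₁ : Measurable π₁) :
    OrthTo (μ₁.prod μ₂) (fun q => (π₁ q.1, π₂ q.2)) (fun q => e q.1) where
  memLp := he.memLp.comp_fst μ₂
  integral_smul_eq_zero ψ hψ hL := by
    have hsq := hL.integrable_sq.prod_left_ae
    rw [integral_prod_symm _ (OrthTo.integrable_smul hL (he.memLp.comp_fst μ₂))]
    refine integral_eq_zero_of_ae (hsq.mono fun ω hω => ?_)
    have hm : Measurable (fun d => ψ (d, π₂ ω)) := hψ.comp (measurable_id.prodMk measurable_const)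
    exact he.integral_smul_eq_zero (fun d => ψ (d, π₂ ω)) hm
      ((memLp_two_iff_integrable_sq (hm.comp h₁).aestronglyMeasurable).2 hω)

theorem OrthTo.prod_snd {e : Λ₂ → E} (he : OrthTo μ₂ π₂ e) (h₂ : Measurable π₂) :
    OrthTo (μ₁.prod μ₂) (fun q => (π₁ q.1, π₂ q.2)) (fun q => e q.2) where
  memLp := he.memLp.comp_snd μ₁
  integral_smul_eq_zero ψ hψ hL := by
    have hsq := hL.integrable_sq.prod_right_ae
    rw [integral_prod _ (OrthTo.integrable_smul hL (he.memLp.comp_snd μ₁))]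
    refine integral_eq_zero_of_ae (hsq.mono fun ω hω => ?_)
    have hm : Measurable (fun d => ψ (π₁ ω, d)) := hψ.comp (measurable_const.prodMk measurable_id)
    exact he.integral_smul_eq_zero (fun d => ψ (π₁ ω, d)) hm
      ((memLp_two_iff_integrable_sq (hm.comp h₂).aestronglyMeasurable).2 hω)

end Product

/-! ### Trajectories against an exogenous environment sequence. -/

namespace LQPlayer

variable {T ny : ℕ} (p : LQPlayer T ny)

section Trajectories

variable (s : p.Strategy) (z : ℕ → RVec ny) (x0 : RVec p.nx) (w : ℕ → RVec p.nx)

/-- The state at time `t` generated by a strategy against an environment sequence. -/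
def stateAt (t : ℕ) : RVec p.nx := (p.privHist s z x0 w t).1 (Fin.last t)

/-- The control at time `t` generated by a strategy against an environment sequence. -/
def controlAt (t : ℕ) : RVec p.nu := s t (p.privHist s z x0 w t, fun k => z k)

theorem stateAt_succ (t : ℕ) : p.stateAt s z x0 w (t + 1)
    = p.A t *ᵥ p.stateAt s z x0 w t + p.B t *ᵥ p.controlAt s z x0 w t + p.C t *ᵥ z t + w t := by
  simp only [stateAt, controlAt, privHist, Fin.snoc_last]

theorem privHist_fst (t : ℕ) (k : Fin (t + 1)) :
    (p.privHist s z x0 w t).1 k = p.stateAt s z x0 w k := by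
  induction t with
  | zero => rw [Fin.fin_one_eq_zero k]; rfl
  | succ t ih =>
    refine Fin.lastCases rfl (fun j => ?_) k
    rw [privHist]
    simp only [Fin.snoc_castSucc, ih, Fin.val_castSucc]

theorem privHist_snd (t : ℕ) (k : Fin t) :
    (p.privHist s z x0 w t).2 k = p.controlAt s z x0 w k := by
  induction t with
  | zero => exact k.elim0
  | succ t ih =>
    refine Fin.lastCases ?_ (fun j => ?_) k
    · rw [privHist]
      simp only [Fin.snoc_last, Fin.val_last, controlAt]
    · rw [privHist]
      simp only [Fin.snoc_castSucc, ih, Fin.val_castSucc]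

theorem totalCost_privHist (z : Fin T → RVec ny) :
    p.totalCost (p.privHist s (extendZero z) x0 w T) z
      = p.pathCost (p.stateAt s (extendZero z) x0 w) (p.controlAt s (extendZero z) x0 w)
        (extendZero z) := by
  simp only [totalCost, pathCost, privHist_fst, privHist_snd, sum_range, Fin.val_castSucc,
    Fin.val_last]
  congr 1
  refine sum_congr rfl fun t _ => ?_
  rw [extendZero_of_lt z t.2]

variable {s z w} in
theorem privHist_congr {z' : ℕ → RVec ny} {w' : ℕ → RVec p.nx} {t : ℕ}
    (hz : ∀ k, k < t → z k = z' k) (hw : ∀ k, k < t → w k = w' k) :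
    p.privHist s z x0 w t = p.privHist s z' x0 w' t := by
  induction t with
  | zero => rfl
  | succ t ih =>
    have e : (fun k : Fin t => z k) = fun k : Fin t => z' k :=
      funext fun k => hz k (k.2.trans (Nat.lt_succ_self t))
    simp only [privHist]
    rw [ih (fun k hk => hz k (by lia)) (fun k hk => hw k (by lia)), e, hz t (by lia),
      hw t (by lia)]

variable {s z w} in
theorem controlAt_congr {z' : ℕ → RVec ny} {w' : ℕ → RVec p.nx} {t : ℕ}
    (hz : ∀ k, k < t → z k = z' k) (hw : ∀ k, k < t → w k = w' k) :
    p.controlAt s z x0 w t = p.controlAt s z' x0 w' t := by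
  have e : (fun k : Fin t => z k) = fun k : Fin t => z' k := funext fun k => hz k k.2
  simp only [controlAt]
  rw [p.privHist_congr x0 hz hw, e]

end Trajectories

section Measurability

variable {Λ : Type*} [MeasurableSpace Λ] {s : p.Strategy} {z : ℕ → Λ → RVec ny}
  {x0 : Λ → RVec p.nx} {w : ℕ → Λ → RVec p.nx}

theorem measurable_privHist (hs : p.IsPure s) (hz : ∀ t, t < T → Measurable (z t))
    (hx : Measurable x0) (hw : ∀ t, t < T → Measurable (w t)) {t : ℕ} (ht : t ≤ T) :
    Measurable (fun ω => p.privHist s (fun k => z k ω) (x0 ω) (fun k => w k ω) t) := by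
  induction t with
  | zero => exact (measurable_pi_lambda _ fun _ => hx).prodMk measurable_const
  | succ t ih =>
    have ih := ih (by lia)
    have hu : Measurable fun ω => s t (p.privHist s (fun k => z k ω) (x0 ω) (fun k => w k ω) t,
        fun k : Fin t => z k ω) :=
      (hs t ht).comp (ih.prodMk (measurable_pi_lambda _ fun k => hz k (k.2.trans ht)))
    have hX : Measurable fun ω =>
        (p.privHist s (fun k => z k ω) (x0 ω) (fun k => w k ω) t).1 (Fin.last t) :=
      (measurable_pi_apply _).comp ih.fst
    simp only [privHist]
    exact (measurable_finSnoc ih.fst (((((measurable_mulVec _).comp hX).add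
      ((measurable_mulVec _).comp hu)).add ((measurable_mulVec _).comp (hz t ht))).add
        (hw t ht))).prodMk (measurable_finSnoc ih.snd hu)

theorem measurable_stateAt (hs : p.IsPure s) (hz : ∀ t, t < T → Measurable (z t))
    (hx : Measurable x0) (hw : ∀ t, t < T → Measurable (w t)) {t : ℕ} (ht : t ≤ T) :
    Measurable (fun ω => p.stateAt s (fun k => z k ω) (x0 ω) (fun k => w k ω) t) :=
  (measurable_pi_apply _).comp (p.measurable_privHist hs hz hx hw ht).fst

theorem measurable_controlAt (hs : p.IsPure s) (hz : ∀ t, t < T → Measurable (z t))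
    (hx : Measurable x0) (hw : ∀ t, t < T → Measurable (w t)) {t : ℕ} (ht : t < T) :
    Measurable (fun ω => p.controlAt s (fun k => z k ω) (x0 ω) (fun k => w k ω) t) :=
  (hs t ht).comp ((p.measurable_privHist hs hz hx hw ht.le).prodMk
    (measurable_pi_lambda _ fun k => hz k (k.2.trans ht)))

theorem measurable_pathCost {x : ℕ → Λ → RVec p.nx} {u : ℕ → Λ → RVec p.nu}
    (hx : ∀ t, t ≤ T → Measurable (x t)) (hu : ∀ t, t < T → Measurable (u t))
    (hz : ∀ t, t < T → Measurable (z t)) :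
    Measurable (fun ω => p.pathCost (fun k => x k ω) (fun k => u k ω) (fun k => z k ω)) := by
  refine (Finset.measurable_sum _ fun t ht => Measurable.const_mul ?_ _).add
    (((measurable_quadForm _).comp (hx T le_rfl)).const_mul _)
  have ht := mem_range.1 ht
  refine (((measurable_quadForm _).comp (hx t ht.le)).add
    ((measurable_quadForm _).comp (hu t ht))).add (Measurable.const_mul ?_ _)
  have hd : Measurable fun q : RVec ny × RVec ny => q.1 ⬝ᵥ q.2 :=
    (continuous_fst.dotProduct continuous_snd).measurable
  exact hd.comp ((hz t ht).prodMk (((measurable_mulVec _).comp (hu t ht)).add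
    ((measurable_mulVec _).comp (hx t ht.le))))

theorem measurable_slack (hz : ∀ t, t < T → Measurable (z t)) :
    Measurable (fun ω => p.slack (fun k => z k ω)) := by
  refine Finset.measurable_sum _ fun t ht => Measurable.const_mul ?_ _
  have ht := mem_range.1 ht
  exact (((measurable_quadForm _).comp ((measurable_mulVec _).comp ((measurable_mulVec _).comp
    (hz t ht)))).const_mul _).add (((measurable_quadForm _).comp ((measurable_mulVec _).comp
      ((measurable_mulVec _).comp (hz t ht)))).const_mul _)

theorem integrable_slack {μ : Measure Λ} (hz : ∀ t, t < T → MemLp (z t) 2 μ) :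
    Integrable (fun ω => p.slack (fun k => z k ω)) μ := by
  refine integrable_finsetSum _ fun t ht => Integrable.const_mul ?_ _
  have hzt := hz t (mem_range.1 ht)
  exact ((integrable_quadForm ((hzt.mulVec _).mulVec _) _).const_mul _).add
    ((integrable_quadForm ((hzt.mulVec _).mulVec _) _).const_mul _)

end Measurability

end LQPlayer

/-! ### Optimality of the certainty equivalent control under a belief. -/

namespace LQPlayer

variable {T ny : ℕ} (p : LQPlayer T ny)

section Optimality

variable {Ω : Type*} {x0 : Ω → RVec p.nx} {w : ℕ → Ω → RVec p.nx} {wHat : ℕ → RVec p.nx}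
  {zhat : ℕ → ∀ t : ℕ, (Fin t → RVec ny) → RVec ny} {s s' : p.Strategy}

/-- The past `(z_k)_{k < t}` of an environment sequence. -/
def envPast (t : ℕ) (z : Fin T → RVec ny) : Fin t → RVec ny := fun k => extendZero z k

theorem measurable_envPast (t : ℕ) :
    Measurable (envPast t : (Fin T → RVec ny) → Fin t → RVec ny) :=
  measurable_pi_lambda _ fun _ => measurable_extendZero _

/-- The primitive information `((z_k)_{k < t}, x_0, (w_k)_{k < t})` at time `t`. -/
def primInfo (x0 : Ω → RVec p.nx) (w : ℕ → Ω → RVec p.nx) (t : ℕ)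
    (q : (Fin T → RVec ny) × Ω) :
    (Fin t → RVec ny) × (RVec p.nx × (Fin t → RVec p.nx)) :=
  (envPast t q.1, (x0 q.2, fun k => w k q.2))

/-- Nonanticipativity: values from time `t` on do not affect the control at `t`, so the past
extended by zero generates the same control. -/
theorem control_factors (hs : p.IsPure s) {t : ℕ} (ht : t < T) :
    ∃ φ : (Fin t → RVec ny) × (RVec p.nx × (Fin t → RVec p.nx)) → RVec p.nu, Measurable φ ∧
      ∀ q : (Fin T → RVec ny) × Ω,
        p.controlAt s (extendZero q.1) (x0 q.2) (fun k => w k q.2) t = φ (p.primInfo x0 w t q) := by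
  refine ⟨fun d => p.controlAt s (extendZero d.1) d.2.1 (extendZero d.2.2) t,
    p.measurable_controlAt (Λ := (Fin t → RVec ny) × (RVec p.nx × (Fin t → RVec p.nx)))
      (z := fun k d => extendZero d.1 k) (x0 := fun d => d.2.1)
      (w := fun k d => extendZero d.2.2 k) hs (fun k _ => (measurable_extendZero k).comp
      measurable_fst) measurable_snd.fst (fun k _ => (measurable_extendZero k).comp
      measurable_snd.snd) ht, fun q => ?_⟩
  refine p.controlAt_congr _ (fun k hk => ?_) (fun k hk => ?_)
  · rw [extendZero_of_lt _ hk]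
    rfl
  · rw [extendZero_of_lt _ hk]
    rfl

/-- `s` is the certainty equivalent control for the environment predictions `zhat`. -/
def IsCertaintyEquivalent (wHat : ℕ → RVec p.nx)
    (zhat : ℕ → ∀ t : ℕ, (Fin t → RVec ny) → RVec ny) (s : p.Strategy) : Prop :=
  ∀ t, t < T → ∀ info, s t info = p.F t *ᵥ info.1.1 (Fin.last t)
    + (∑ n ∈ Ico t T, p.G t n *ᵥ zhat n t info.2 + p.H wHat t)

variable {p} in
theorem IsCertaintyEquivalent.controlAt (hs : p.IsCertaintyEquivalent wHat zhat s)
    {t : ℕ} (ht : t < T) (z : Fin T → RVec ny) (x : RVec p.nx) (v : ℕ → RVec p.nx) :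
    p.controlAt s (extendZero z) x v t = p.F t *ᵥ p.stateAt s (extendZero z) x v t
      + (∑ n ∈ Ico t T, p.G t n *ᵥ zhat n t (envPast t z) + p.H wHat t) :=
  hs t ht _

/-- The cost of `s`, shifted by the slack so as to be nonnegative. -/
def shiftedCost (x0 : Ω → RVec p.nx) (w : ℕ → Ω → RVec p.nx) (s : p.Strategy)
    (q : (Fin T → RVec ny) × Ω) : ℝ :=
  p.pathCost (p.stateAt s (extendZero q.1) (x0 q.2) (fun k => w k q.2))
    (p.controlAt s (extendZero q.1) (x0 q.2) (fun k => w k q.2)) (extendZero q.1)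
    + p.slack (extendZero q.1)

theorem shiftedCost_nonneg (q : (Fin T → RVec ny) × Ω) : 0 ≤ p.shiftedCost x0 w s q :=
  p.pathCost_add_slack_nonneg _ _ _

variable [MeasurableSpace Ω] {μ : Measure Ω} {ζ : Measure (Fin T → RVec ny)}

/-- Exogeneity enters here: under `ζ.prod μ` the prediction errors of `z` are also orthogonal to
private information, and the private noise to past `z`. -/
theorem orthTo_gradient [IsProbabilityMeasure μ] [IsProbabilityMeasure ζ]
    (hs : p.IsCertaintyEquivalent wHat zhat s) (hx0 : Measurable x0)
    (hw : ∀ t, t < T → Measurable (w t))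
    (hzO : ∀ n t, t ≤ n → n < T →
      OrthTo ζ (envPast t) (fun z => extendZero z n - zhat n t (envPast t z)))
    (hwO : ∀ t, t < T →
      OrthTo μ (fun ω => (x0 ω, fun k : Fin t => w k ω)) (fun ω => w t ω - wHat t))
    {t : ℕ} (ht : t < T) :
    OrthTo (ζ.prod μ) (p.primInfo x0 w t) (fun q => p.gradient
      (p.stateAt s (extendZero q.1) (x0 q.2) (fun k => w k q.2))
      (p.controlAt s (extendZero q.1) (x0 q.2) (fun k => w k q.2)) (extendZero q.1) t) := by
  refine (p.orthTo_costate_and_gradient (μ := ζ.prod μ) (π := fun t => p.primInfo x0 w t)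
    (x := fun k q => p.stateAt s (extendZero q.1) (x0 q.2) (fun k => w k q.2) k)
    (w := fun k q => w k q.2)
    (u := fun k q => p.controlAt s (extendZero q.1) (x0 q.2) (fun k => w k q.2) k)
    (z := fun k q => extendZero q.1 k) (zhat := fun n t q => zhat n t (envPast t q.1))
    (wHat := wHat) ?_ ?_ ?_ ?_ ?_ ht).2
  · refine fun t _ => ⟨fun d => (fun k => d.1 k.castSucc, (d.2.1, fun k => d.2.2 k.castSucc)),
      ?_, fun q => rfl⟩
    exact (measurable_pi_lambda _ fun k => (measurable_pi_apply _).comp measurable_fst).prodMk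
      (measurable_snd.fst.prodMk
        (measurable_pi_lambda _ fun k => (measurable_pi_apply _).comp measurable_snd.snd))
  · exact fun n t htn hn => (hzO n t htn hn).prod_fst
      (π₂ := fun ω => (x0 ω, fun k : Fin t => w k ω)) (measurable_envPast t)
  · exact fun t ht => (hwO t ht).prod_snd
      (hx0.prodMk (measurable_pi_lambda _ fun k => hw k (k.2.trans ht)))
  · exact fun t _ q => p.stateAt_succ _ _ _ _ t
  · exact fun t ht q => hs.controlAt ht _ _ _

theorem memLp_state_control [IsProbabilityMeasure μ] [IsProbabilityMeasure ζ]
    (hs : p.IsCertaintyEquivalent wHat zhat s)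
    (hx0 : MemLp x0 2 μ) (hw : ∀ t, t < T → MemLp (w t) 2 μ)
    (hz : ∀ t, t < T → MemLp (fun z : Fin T → RVec ny => extendZero z t) 2 ζ)
    (hzO : ∀ n t, t ≤ n → n < T →
      OrthTo ζ (envPast t) (fun z => extendZero z n - zhat n t (envPast t z)))
    {t : ℕ} (ht : t < T) :
    MemLp (fun q : (Fin T → RVec ny) × Ω =>
      p.stateAt s (extendZero q.1) (x0 q.2) (fun k => w k q.2) t) 2 (ζ.prod μ) ∧
    MemLp (fun q : (Fin T → RVec ny) × Ω =>
      p.controlAt s (extendZero q.1) (x0 q.2) (fun k => w k q.2) t) 2 (ζ.prod μ) := by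
  have hzhat : ∀ n t, t ≤ n → n < T →
      MemLp (fun q : (Fin T → RVec ny) × Ω => zhat n t (envPast t q.1)) 2 (ζ.prod μ) := by
    intro n t htn hn
    -- A prediction is the predicted variable minus its error, and both are square integrable.
    have h := ((hz n hn).sub (hzO n t htn hn).memLp).comp_fst μ
    refine (memLp_congr_ae (.of_forall fun q => ?_)).1 h
    simp
  have hctl : ∀ t, t < T → MemLp (fun q : (Fin T → RVec ny) × Ω =>
      p.stateAt s (extendZero q.1) (x0 q.2) (fun k => w k q.2) t) 2 (ζ.prod μ) →
      MemLp (fun q : (Fin T → RVec ny) × Ω =>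
        p.controlAt s (extendZero q.1) (x0 q.2) (fun k => w k q.2) t) 2 (ζ.prod μ) := by
    intro t ht hx
    simp only [hs.controlAt ht]
    exact (hx.mulVec _).add ((memLp_finsetSum _ fun n hn => (hzhat n t (mem_Ico.1 hn).1
      (mem_Ico.1 hn).2).mulVec _).add (memLp_const _))
  refine (fun hx => ⟨hx, hctl t ht hx⟩) ?_
  induction t with
  | zero => exact hx0.comp_snd ζ
  | succ t ih =>
    have hx := ih (by lia)
    simp only [stateAt_succ]
    exact (((hx.mulVec _).add ((hctl t (by lia) hx).mulVec _)).add
      (((hz t (by lia)).comp_fst μ).mulVec _)).add ((hw t (by lia)).comp_snd ζ)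

theorem measurable_shiftedCost (hs : p.IsPure s) (hx0 : Measurable x0)
    (hw : ∀ t, t < T → Measurable (w t)) : Measurable (p.shiftedCost (Ω := Ω) x0 w s) := by
  have hz : ∀ t, t < T → Measurable (fun q : (Fin T → RVec ny) × Ω => extendZero q.1 t) :=
    fun t _ => (measurable_extendZero t).comp measurable_fst
  have hx : Measurable (fun q : (Fin T → RVec ny) × Ω => x0 q.2) := hx0.comp measurable_snd
  have hw' : ∀ t, t < T → Measurable (fun q : (Fin T → RVec ny) × Ω => w t q.2) :=
    fun t ht => (hw t ht).comp measurable_snd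
  exact (p.measurable_pathCost (fun t ht => p.measurable_stateAt hs hz hx hw' ht)
    (fun t ht => p.measurable_controlAt hs hz hx hw' ht) hz).add (p.measurable_slack hz)

/-- Positivity of `β ^ t` is essential: a control with zero discount factor does not affect the cost
bound and may be arbitrarily large. -/
theorem memLp_control_of_integrable (hs : p.IsPure s) (hx0 : Measurable x0)
    (hw : ∀ t, t < T → Measurable (w t)) (hi : Integrable (p.shiftedCost x0 w s) (ζ.prod μ))
    {t : ℕ} (ht : t < T) (hβ : 0 < p.β ^ t) :
    MemLp (fun q : (Fin T → RVec ny) × Ω =>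
      p.controlAt s (extendZero q.1) (x0 q.2) (fun k => w k q.2) t) 2 (ζ.prod μ) := by
  have hm := p.measurable_controlAt
    (z := fun k (q : (Fin T → RVec ny) × Ω) => extendZero q.1 k) (x0 := fun q => x0 q.2)
    (w := fun k q => w k q.2) hs
    (fun t _ => (measurable_extendZero t).comp measurable_fst) (hx0.comp measurable_snd)
    (fun t ht => (hw t ht).comp measurable_snd) ht
  refine memLp_pi_iff.2 fun j => ?_
  have hmj := (measurable_pi_apply j).comp hm
  obtain ⟨c, hc, hle⟩ := exists_sq_le_quadForm (p.R_pos t ht) j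
  refine (memLp_two_iff_integrable_sq hmj.aestronglyMeasurable).2 ?_
  refine (hi.const_mul (c * (2 / p.β ^ t))).mono' (hmj.pow_const 2).aestronglyMeasurable
    (.of_forall fun q => ?_)
  rw [Real.norm_eq_abs, abs_of_nonneg (sq_nonneg _)]
  refine (hle _).trans ?_
  rw [mul_assoc]
  refine mul_le_mul_of_nonneg_left ?_ hc.le
  have h := p.quadForm_control_le (p.stateAt s (extendZero q.1) (x0 q.2) (fun k => w k q.2))
    (p.controlAt s (extendZero q.1) (x0 q.2) (fun k => w k q.2)) (extendZero q.1) ht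
  rw [div_mul_eq_mul_div, le_div_iff₀ hβ, mul_comm]
  exact h

/-- The certainty equivalent control minimizes the expected cost. -/
theorem lintegral_shiftedCost_le [IsProbabilityMeasure μ] [IsProbabilityMeasure ζ]
    (hs : p.IsCertaintyEquivalent wHat zhat s) (hpure : p.IsPure s)
    (hpure' : p.IsPure s') (hx0m : Measurable x0) (hwm : ∀ t, t < T → Measurable (w t))
    (hx0 : MemLp x0 2 μ) (hw : ∀ t, t < T → MemLp (w t) 2 μ)
    (hz : ∀ t, t < T → MemLp (fun z : Fin T → RVec ny => extendZero z t) 2 ζ)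
    (hzO : ∀ n t, t ≤ n → n < T →
      OrthTo ζ (envPast t) (fun z => extendZero z n - zhat n t (envPast t z)))
    (hwO : ∀ t, t < T →
      OrthTo μ (fun ω => (x0 ω, fun k : Fin t => w k ω)) (fun ω => w t ω - wHat t)) :
    ∫⁻ q, ENNReal.ofReal (p.shiftedCost x0 w s q) ∂(ζ.prod μ)
      ≤ ∫⁻ q, ENNReal.ofReal (p.shiftedCost x0 w s' q) ∂(ζ.prod μ) := by
  by_cases htop : ∫⁻ q, ENNReal.ofReal (p.shiftedCost x0 w s' q) ∂(ζ.prod μ) = ⊤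
  · rw [htop]
    exact le_top
  have hm' := p.measurable_shiftedCost hpure' hx0m hwm
  have hi : Integrable (p.shiftedCost x0 w s') (ζ.prod μ) :=
    (lintegral_ofReal_ne_top_iff_integrable hm'.aestronglyMeasurable
      (.of_forall fun q => p.shiftedCost_nonneg q)).1 htop
  set grad : ℕ → (Fin T → RVec ny) × Ω → RVec p.nu := fun t q => p.gradient
      (p.stateAt s (extendZero q.1) (x0 q.2) (fun k => w k q.2))
      (p.controlAt s (extendZero q.1) (x0 q.2) (fun k => w k q.2)) (extendZero q.1) t with hgrad
  set du : ℕ → (Fin T → RVec ny) × Ω → RVec p.nu := fun t q =>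
      p.controlAt s' (extendZero q.1) (x0 q.2) (fun k => w k q.2) t
        - p.controlAt s (extendZero q.1) (x0 q.2) (fun k => w k q.2) t with hdu
  have hterm : ∀ t ∈ range T, Integrable (fun q => p.β ^ t * (grad t q ⬝ᵥ du t q)) (ζ.prod μ) ∧
      ∫ q, p.β ^ t * (grad t q ⬝ᵥ du t q) ∂(ζ.prod μ) = 0 := by
    intro t ht
    have ht := mem_range.1 ht
    rcases (pow_nonneg p.β_nonneg t).eq_or_lt with h0 | hpos
    -- The control change need not be square integrable here, but its term has weight zero.
    · simp [← h0]
    have hg := p.orthTo_gradient hs hx0m hwm hzO hwO ht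
    have hduL : MemLp (du t) 2 (ζ.prod μ) :=
      (p.memLp_control_of_integrable hpure' hx0m hwm hi ht hpos).sub
        (p.memLp_state_control hs hx0 hw hz hzO ht).2
    refine ⟨(integrable_dotProduct hg.memLp hduL).const_mul _, ?_⟩
    obtain ⟨φ, hφ, hφe⟩ := p.control_factors (x0 := x0) (w := w) hpure ht
    obtain ⟨φ', hφ', hφe'⟩ := p.control_factors (x0 := x0) (w := w) hpure' ht
    have hdue : ∀ j q, du t q j = φ' (p.primInfo x0 w t q) j - φ (p.primInfo x0 w t q) j :=
      fun j q => by rw [← hφe, ← hφe']; rfl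
    rw [integral_const_mul]
    simp only [dotProduct]
    have hgj : ∀ j, Integrable (fun q => grad t q j * du t q j) (ζ.prod μ) :=
      fun j => (hg.memLp.eval j).integrable_mul (hduL.eval j)
    rw [integral_finsetSum _ fun j _ => hgj j]
    refine mul_eq_zero_of_right _ (sum_eq_zero fun j _ => ?_)
    -- Both controls are functions of the primitive information, so each coordinate of their
    -- difference is an admissible test function.
    have hj := (hg.linear (LinearMap.proj j : RVec p.nu →ₗ[ℝ] ℝ)).integral_smul_eq_zero
      (fun d => φ' d j - φ d j)
      (((measurable_pi_apply j).comp hφ').sub ((measurable_pi_apply j).comp hφ))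
      ((memLp_congr_ae (.of_forall fun q => hdue j q)).1 (hduL.eval j))
    rw [← hj]
    refine integral_congr_ae (.of_forall fun q => ?_)
    simp only [hdue, smul_eq_mul, LinearMap.proj_apply]
    exact mul_comm _ _
  set rest : (Fin T → RVec ny) × Ω → ℝ := fun q =>
    2 * ∑ t ∈ range T, p.β ^ t * (grad t q ⬝ᵥ du t q) with hrest
  have hrestI : Integrable rest (ζ.prod μ) :=
    (integrable_finsetSum _ fun t ht => (hterm t ht).1).const_mul 2
  have hrest0 : ∫ q, rest q ∂(ζ.prod μ) = 0 := by
    simp only [hrest]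
    rw [integral_const_mul, integral_finsetSum _ fun t ht => (hterm t ht).1,
      sum_eq_zero fun t ht => (hterm t ht).2, mul_zero]
  -- The slack depends on `z` only and cancels from the first-order bound.
  have hle : ∀ q, p.shiftedCost x0 w s q ≤ p.shiftedCost x0 w s' q - rest q := by
    intro q
    have h := p.pathCost_add_gradient_le
      (x := p.stateAt s (extendZero q.1) (x0 q.2) (fun k => w k q.2))
      (x' := p.stateAt s' (extendZero q.1) (x0 q.2) (fun k => w k q.2))
      (u := p.controlAt s (extendZero q.1) (x0 q.2) (fun k => w k q.2))
      (u' := p.controlAt s' (extendZero q.1) (x0 q.2) (fun k => w k q.2))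
      (extendZero q.1) rfl (fun t _ => by
        simp only [stateAt_succ, Matrix.mulVec_sub]
        abel)
    simp only [shiftedCost, hrest, hgrad, hdu]
    linarith
  calc ∫⁻ q, ENNReal.ofReal (p.shiftedCost x0 w s q) ∂(ζ.prod μ)
      ≤ ∫⁻ q, ENNReal.ofReal (p.shiftedCost x0 w s' q - rest q) ∂(ζ.prod μ) :=
        lintegral_mono fun q => ENNReal.ofReal_le_ofReal (hle q)
    _ = ENNReal.ofReal (∫ q, (p.shiftedCost x0 w s' q - rest q) ∂(ζ.prod μ)) :=
        (ofReal_integral_eq_lintegral_ofReal (hi.sub hrestI)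
          (.of_forall fun q => (p.shiftedCost_nonneg q).trans (hle q))).symm
    _ = ENNReal.ofReal (∫ q, p.shiftedCost x0 w s' q ∂(ζ.prod μ)) := by
        rw [integral_sub hi hrestI, hrest0, sub_zero]
    _ = _ := ofReal_integral_eq_lintegral_ofReal hi
        (.of_forall fun q => p.shiftedCost_nonneg q)

end Optimality

end LQPlayer

/-! ### Affine dependence and time consistency of the prediction equations. -/

namespace LQGame

section Linearity

variable (g : LQGame)

theorem isLinearMap_cD (t : ℕ) : IsLinearMap ℝ (cD g t) where
  map_add X X' := by
    simp only [cD, Prod.fst_add, Prod.snd_add, Pi.add_apply, Matrix.mulVec_add, sum_add_distrib]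
    abel
  map_smul c X := by
    simp only [cD, Prod.smul_fst, Prod.smul_snd, Pi.smul_apply, Matrix.mulVec_smul, smul_add,
      sum_add_distrib, smul_sum]

theorem isLinearMap_cGp (t n : ℕ) : IsLinearMap ℝ (cGp g t n) where
  map_add y y' := by simp only [cGp, Matrix.mulVec_add, sum_add_distrib]
  map_smul c y := by simp only [cGp, Matrix.mulVec_smul, smul_sum]

theorem isLinearMap_cA (t : ℕ) : IsLinearMap ℝ (cA g t) where
  map_add X X' := by
    refine Prod.ext ?_ (funext fun i => ?_) <;>
      simp only [cA, Prod.fst_add, Prod.snd_add, Pi.add_apply, Matrix.mulVec_add,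
        sum_add_distrib] <;> abel
  map_smul c X := by
    refine Prod.ext ?_ (funext fun i => ?_) <;>
      simp only [cA, Prod.smul_fst, Prod.smul_snd, Pi.smul_apply, Matrix.mulVec_smul, smul_add,
        sum_add_distrib, smul_sum]

theorem isLinearMap_cGX (t n : ℕ) : IsLinearMap ℝ (cGX g t n) where
  map_add y y' := by
    refine Prod.ext ?_ (funext fun i => ?_) <;>
      simp only [cGX, Prod.fst_add, Prod.snd_add, Pi.add_apply, Matrix.mulVec_add,
        sum_add_distrib]
  map_smul c y := by
    refine Prod.ext ?_ (funext fun i => ?_) <;>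
      simp only [cGX, Prod.smul_fst, Prod.smul_snd, Pi.smul_apply, Matrix.mulVec_smul, smul_sum]

theorem isLinearMap_cC (t : ℕ) : IsLinearMap ℝ (cC g t) where
  map_add y y' := by
    refine Prod.ext ?_ (funext fun i => ?_) <;>
      simp only [cC, Prod.fst_add, Prod.snd_add, Pi.add_apply, Matrix.mulVec_add, add_zero]
  map_smul c y := by
    refine Prod.ext ?_ (funext fun i => ?_) <;>
      simp only [cC, Prod.smul_fst, Prod.smul_snd, Pi.smul_apply, Matrix.mulVec_smul, smul_zero]

end Linearity

variable {g : LQGame} {Ω : Type*} [MeasurableSpace Ω] {μ : Measure Ω} {P : g.Primitives Ω}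

section Affine

theorem EqSys.congr {k : ℕ} {Xk : g.State} {yh yh' : ℕ → g.Y} {Xh : ℕ → g.State}
    (h : EqSys μ P k Xk yh Xh) (hy : ∀ t, k ≤ t → t < g.T → yh' t = yh t) :
    EqSys μ P k Xk yh' Xh := by
  refine ⟨h.1, fun t hkt ht => ?_⟩
  have e1 : ∑ n ∈ Ico t g.T, cGp g t n (yh' n) = ∑ n ∈ Ico t g.T, cGp g t n (yh n) :=
    sum_congr rfl fun n hn => by rw [hy n (hkt.trans (mem_Ico.1 hn).1) (mem_Ico.1 hn).2]
  have e2 : ∑ n ∈ Ico t g.T, cGX g t n (yh' n) = ∑ n ∈ Ico t g.T, cGX g t n (yh n) :=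
    sum_congr rfl fun n hn => by rw [hy n (hkt.trans (mem_Ico.1 hn).1) (mem_Ico.1 hn).2]
  rw [e1, e2, hy t hkt ht]
  exact h.2 t hkt ht

/-- This one combination yields additivity (`X₀ = 0`, `c = 1`) and homogeneity (`X = X₀ = 0`) of the
linear part of the solution. -/
theorem EqSys.affineComb {k : ℕ} {X X' X₀ : g.State} {y y' y₀ : ℕ → g.Y}
    {Xh Xh' Xh₀ : ℕ → g.State} (h : EqSys μ P k X y Xh) (h' : EqSys μ P k X' y' Xh')
    (h₀ : EqSys μ P k X₀ y₀ Xh₀) (c : ℝ) :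
    EqSys μ P k (X + c • (X' - X₀)) (fun t => y t + c • (y' t - y₀ t))
      (fun t => Xh t + c • (Xh' t - Xh₀ t)) := by
  refine ⟨by simp only [h.1, h'.1, h₀.1], fun t hkt ht => ?_⟩
  obtain ⟨a1, a2⟩ := h.2 t hkt ht
  obtain ⟨b1, b2⟩ := h'.2 t hkt ht
  obtain ⟨c1, c2⟩ := h₀.2 t hkt ht
  have e1 : ∑ n ∈ Ico t g.T, cGp g t n (y n + c • (y' n - y₀ n))
      = ∑ n ∈ Ico t g.T, cGp g t n (y n) + c • (∑ n ∈ Ico t g.T, cGp g t n (y' n)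
        - ∑ n ∈ Ico t g.T, cGp g t n (y₀ n)) := by
    simp only [(isLinearMap_cGp g t _).map_add, (isLinearMap_cGp g t _).map_smul,
      (isLinearMap_cGp g t _).map_sub, sum_add_distrib, ← smul_sum, sum_sub_distrib]
  have e2 : ∑ n ∈ Ico t g.T, cGX g t n (y n + c • (y' n - y₀ n))
      = ∑ n ∈ Ico t g.T, cGX g t n (y n) + c • (∑ n ∈ Ico t g.T, cGX g t n (y' n)
        - ∑ n ∈ Ico t g.T, cGX g t n (y₀ n)) := by
    simp only [(isLinearMap_cGX g t _).map_add, (isLinearMap_cGX g t _).map_smul,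
      (isLinearMap_cGX g t _).map_sub, sum_add_distrib, ← smul_sum, sum_sub_distrib]
  constructor
  · rw [e1, (isLinearMap_cD g t).map_add, (isLinearMap_cD g t).map_smul,
      (isLinearMap_cD g t).map_sub]
    beta_reduce
    rw [a1, b1, c1]
    module
  · rw [e2, (isLinearMap_cA g t).map_add, (isLinearMap_cA g t).map_smul,
      (isLinearMap_cA g t).map_sub, (isLinearMap_cC g t).map_add, (isLinearMap_cC g t).map_smul,
      (isLinearMap_cC g t).map_sub]
    beta_reduce
    rw [a2, b2, c2]
    module

theorem exists_isAffineSolution (h : UniquelySolvable μ P) :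
    ∃ a b, IsAffineSolution μ P (g := g) a b := by
  choose y Xh hy using fun k hk X => (h k hk X).1
  have uniq := fun k hk X => (h k hk X).2
  have comb : ∀ k hk t, k ≤ t → t < g.T → ∀ (X X' X₀ : g.State) (c : ℝ),
      y k hk (X + c • (X' - X₀)) t
        = y k hk X t + c • (y k hk X' t - y k hk X₀ t) := fun k hk t hkt ht X X' X₀ c =>
    uniq k hk _ _ _ _ _ (hy k hk _) ((hy k hk X).affineComb (hy k hk X') (hy k hk X₀) c) t hkt ht
  -- The constant is the solution started at `0`, and the linear part is the deviation from it.
  -- Indices outside `k ≤ t < T` are irrelevant and get `0`.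
  refine ⟨fun t k => if H : k ≤ t ∧ t < g.T then
      { toFun := fun X => y k (H.1.trans_lt H.2) X t - y k (H.1.trans_lt H.2) 0 t
        map_add' := fun X X' => ?_
        map_smul' := fun c X => ?_ } else 0,
    fun t k => if H : k < g.T then y k H 0 t else 0, fun k hk Xk => ⟨Xh k hk Xk, ?_⟩⟩
  · have e := comb k (H.1.trans_lt H.2) t H.1 H.2 X X' 0 1
    rw [sub_zero, one_smul, one_smul] at e
    rw [e]
    abel
  · have e := comb k (H.1.trans_lt H.2) t H.1 H.2 0 X 0 c
    rw [sub_zero, zero_add] at e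
    rw [e, RingHom.id_apply]
    abel
  · refine (hy k hk Xk).congr fun t hkt ht => ?_
    simp [hkt, ht, hk]

variable {a : ℕ → ℕ → (g.State →ₗ[ℝ] g.Y)} {b : ℕ → ℕ → g.Y}

/-- Predictions made at time `k` are consistent with those made at the predicted state at time
`k + 1`. -/
theorem IsAffineSolution.exists_next (h : UniquelySolvable μ P) (hab : IsAffineSolution μ P a b)
    {k : ℕ} (hk : k < g.T) (X : g.State) :
    ∃ X' : g.State,
      X' = cA g k X + ∑ n ∈ Ico k g.T, cGX g k n (a n k X + b n k) + cHX μ P k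
        + cC g k (a k k X + b k k) + WHat μ P k ∧
      ∀ n, k < n → n < g.T → a n k X + b n k = a n (k + 1) X' + b n (k + 1) := by
  obtain ⟨Xh, h0, hX⟩ := hab k hk X
  refine ⟨Xh (k + 1), ?_, fun n hkn hn => ?_⟩
  · have := (hX k le_rfl hk).2
    rwa [h0] at this
  · have hk1 : k + 1 < g.T := by lia
    obtain ⟨Xh', hX'⟩ := hab (k + 1) hk1 (Xh (k + 1))
    -- The remainder of a solution from time `k` solves the equations restarted at `Xh (k + 1)`,
    -- where the solution is unique.
    exact (h (k + 1) hk1 (Xh (k + 1))).2 _ _ _ _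
      ⟨rfl, fun t ht htT => hX t (by lia) htT⟩ hX' n hkn hn

theorem IsAffineSolution.output (hab : IsAffineSolution μ P a b)
    {k : ℕ} (hk : k < g.T) (X : g.State) :
    a k k X + b k k = cD g k X + ∑ n ∈ Ico k g.T, cGp g k n (a n k X + b n k) + cHp μ P k
      + ξHat μ P k := by
  obtain ⟨Xh, h0, hX⟩ := hab k hk X
  have := (hX k le_rfl hk).1
  rwa [h0] at this

end Affine

/-! ### From integrals of shifted costs to optimality in extended expectation. -/

section Optimal

variable (μ P) in
-- For fixed `z` the slack is a finite constant under `μ`, so it can be added inside the expectation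
-- and subtracted outside.
theorem cost_eq_sub [IsProbabilityMeasure μ] (i : Fin g.N) {s : (g.player i).Strategy}
    (hs : (g.player i).IsPure s) (hX0 : Measurable P.X0)
    (hW : ∀ t, t < g.T → Measurable (P.W t)) (z : Fin g.T → g.Y) :
    cost μ P i s z = ((∫⁻ ω, ENNReal.ofReal ((g.player i).shiftedCost (fun ω => (P.X0 ω).2 i)
        (fun t ω => (P.W t ω).2 i) s (z, ω)) ∂μ : ℝ≥0∞) : EReal)
      - (ENNReal.ofReal ((g.player i).slack (extendZero z)) : EReal) := by
  have hm := (g.player i).measurable_shiftedCost (x0 := fun ω => (P.X0 ω).2 i)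
    (w := fun t ω => (P.W t ω).2 i) hs ((measurable_pi_apply i).comp hX0.snd)
    (fun t ht => (measurable_pi_apply i).comp (hW t ht).snd)
  have e := eexp_sub (μ := μ) (H := fun ω => ENNReal.ofReal ((g.player i).shiftedCost
    (fun ω => (P.X0 ω).2 i) (fun t ω => (P.W t ω).2 i) s (z, ω)))
    (C := fun _ => ENNReal.ofReal ((g.player i).slack (extendZero z)))
    (hm.comp measurable_prodMk_left).ennreal_ofReal measurable_const
    (fun _ => ENNReal.ofReal_ne_top) (by simp)
  rw [lintegral_const, measure_univ, mul_one] at e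
  rw [← e, cost]
  congr 1
  funext ω
  have h0 := (g.player i).shiftedCost_nonneg (x0 := fun ω => (P.X0 ω).2 i)
    (w := fun t ω => (P.W t ω).2 i) (s := s) (z, ω)
  rw [EReal.coe_ennreal_ofReal, EReal.coe_ennreal_ofReal, max_eq_left h0,
    max_eq_left ((g.player i).slack_nonneg _), ← EReal.coe_sub]
  congr 1
  rw [LQPlayer.shiftedCost, add_sub_cancel_right]
  exact (g.player i).totalCost_privHist _ _ _ _

/-- By Tonelli each objective is the integral of a nonnegative shifted cost minus the same finite
slack integral, so all objectives are well defined and ordered as their shifted costs. -/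
theorem isOptimal_of_lintegral_le [IsProbabilityMeasure μ] (i : Fin g.N)
    {ζ : Measure (Fin g.T → g.Y)} [IsProbabilityMeasure ζ] {s : (g.player i).Strategy}
    (hs : (g.player i).IsPure s) (hX0 : Measurable P.X0)
    (hW : ∀ t, t < g.T → Measurable (P.W t))
    (hz : ∀ t, t < g.T → MemLp (fun z : Fin g.T → g.Y => extendZero z t) 2 ζ)
    (hle : ∀ s' : (g.player i).Strategy, (g.player i).IsPure s' →
      ∫⁻ q, ENNReal.ofReal ((g.player i).shiftedCost (fun ω => (P.X0 ω).2 i)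
        (fun t ω => (P.W t ω).2 i) s q) ∂(ζ.prod μ)
      ≤ ∫⁻ q, ENNReal.ofReal ((g.player i).shiftedCost (fun ω => (P.X0 ω).2 i)
        (fun t ω => (P.W t ω).2 i) s' q) ∂(ζ.prod μ)) :
    IsOptimal μ P i ζ s := by
  intro s' hs'
  have hC : ∫⁻ z : Fin g.T → g.Y, ENNReal.ofReal ((g.player i).slack (extendZero z)) ∂ζ ≠ ⊤ :=
    (lintegral_ofReal_ne_top_iff_integrable
      ((g.player i).measurable_slack fun t _ => measurable_extendZero t).aestronglyMeasurable
      (.of_forall fun z => (g.player i).slack_nonneg _)).2 ((g.player i).integrable_slack hz)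
  have hCm : Measurable fun z : Fin g.T → g.Y =>
      ENNReal.ofReal ((g.player i).slack (extendZero z)) :=
    ((g.player i).measurable_slack fun t _ => measurable_extendZero t).ennreal_ofReal
  have hm : ∀ r : (g.player i).Strategy, (g.player i).IsPure r →
      Measurable fun q => ENNReal.ofReal ((g.player i).shiftedCost (fun ω => (P.X0 ω).2 i)
        (fun t ω => (P.W t ω).2 i) r q) := fun r hr =>
    ((g.player i).measurable_shiftedCost hr ((measurable_pi_apply i).comp hX0.snd)
      (fun t ht => (measurable_pi_apply i).comp (hW t ht).snd)).ennreal_ofReal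
  have value : ∀ r : (g.player i).Strategy, (g.player i).IsPure r →
      HasEExp ζ (cost μ P i r) ∧ eexp ζ (cost μ P i r)
        = ((∫⁻ q, ENNReal.ofReal ((g.player i).shiftedCost (fun ω => (P.X0 ω).2 i)
          (fun t ω => (P.W t ω).2 i) r q) ∂(ζ.prod μ) : ℝ≥0∞) : EReal)
          - ((∫⁻ z : Fin g.T → g.Y, ENNReal.ofReal ((g.player i).slack (extendZero z)) ∂ζ : ℝ≥0∞)
            : EReal) := by
    intro r hr
    rw [funext (cost_eq_sub μ P i hr hX0 hW)]
    refine ⟨hasEExp_sub (fun _ => ENNReal.ofReal_ne_top) hC, ?_⟩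
    rw [eexp_sub (hm r hr).lintegral_prod_right' hCm (fun _ => ENNReal.ofReal_ne_top) hC,
      lintegral_prod _ (hm r hr).aemeasurable]
  refine ⟨(value s' hs').1, ?_⟩
  rw [(value s hs).2, (value s' hs').2]
  exact EReal.sub_le_sub (by exact_mod_cast hle s' hs') le_rfl

end Optimal

end LQGame

/-! ### Linear images and image measures. -/

section IsLinearMap

variable {E F : Type*} [NormedAddCommGroup E] [NormedSpace ℝ E] [FiniteDimensional ℝ E]
  [NormedAddCommGroup F] [NormedSpace ℝ F] {f : E → F}

theorem IsLinearMap.measurable [MeasurableSpace E] [BorelSpace E] [MeasurableSpace F]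
    [BorelSpace F] (hf : IsLinearMap ℝ f) : Measurable f :=
  (hf.mk' f).toContinuousLinearMap.continuous.measurable

variable {Λ : Type*} [MeasurableSpace Λ] {μ : Measure Λ}

theorem IsLinearMap.memLp (hf : IsLinearMap ℝ f) {h : Λ → E} (hh : MemLp h 2 μ) :
    MemLp (fun ω => f (h ω)) 2 μ :=
  (hf.mk' f).toContinuousLinearMap.comp_memLp' hh

theorem IsLinearMap.orthTo [CompleteSpace F] (hf : IsLinearMap ℝ f) {D : Type*}
    [MeasurableSpace D] {π : Λ → D} {h : Λ → E} (hh : OrthTo μ π h) :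
    OrthTo μ π (fun ω => f (h ω)) :=
  hh.linear (hf.mk' f)

end IsLinearMap

theorem OrthTo.map {Λ Λ' D E : Type*} [MeasurableSpace Λ] [MeasurableSpace Λ'] [MeasurableSpace D]
    [NormedAddCommGroup E] [NormedSpace ℝ E] {μ : Measure Λ} {f : Λ → Λ'} {π : Λ' → D} {e : Λ' → E}
    (hf : Measurable f) (hπ : Measurable π) (he : StronglyMeasurable e)
    (h : OrthTo μ (fun ω => π (f ω)) (fun ω => e (f ω))) : OrthTo (μ.map f) π e where
  memLp := (memLp_map_measure_iff he.aestronglyMeasurable hf.aemeasurable).2 h.memLp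
  integral_smul_eq_zero ψ hψ hL := by
    have hm : StronglyMeasurable (fun x => ψ (π x)) := (hψ.comp hπ).stronglyMeasurable
    have hi : StronglyMeasurable (fun x => ψ (π x) • e x) := hm.smul he
    rw [integral_map hf.aemeasurable hi.aestronglyMeasurable]
    exact h.integral_smul_eq_zero ψ hψ
      ((memLp_map_measure_iff hm.aestronglyMeasurable hf.aemeasurable).1 hL)

/-! ### Existence and square integrability of the replica, and its estimator. -/

namespace LQGame

variable {g : LQGame} {Ω : Type*} [MeasurableSpace Ω] {μ : Measure Ω} {P : g.Primitives Ω}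
  {a : ℕ → ℕ → (g.State →ₗ[ℝ] g.Y)} {b : ℕ → ℕ → g.Y}

section Replica

variable (μ P a b) in
/-- Right-hand side of the output equation, for the state estimate `X̂`. -/
def outputRHS (t : ℕ) (Xh X : g.State) (ξ : g.Y) : g.Y :=
  cD g t X + ∑ n ∈ Ico t g.T, cGp g t n (a n t Xh + b n t) + cHp μ P t + ξ

variable (μ P a b) in
/-- Right-hand side of the state equation, for the state estimate `X̂`. -/
def stepRHS (t : ℕ) (Xh X : g.State) (y : g.Y) (W : g.State) : g.State :=
  cA g t X + ∑ n ∈ Ico t g.T, cGX g t n (a n t Xh + b n t) + cHX μ P t + cC g t y + W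

theorem measurable_outputRHS {Λ : Type*} [MeasurableSpace Λ] {t : ℕ} {Xh X : Λ → g.State}
    {ξ : Λ → g.Y} (hXh : Measurable Xh) (hX : Measurable X) (hξ : Measurable ξ) :
    Measurable (fun ω => outputRHS μ P a b t (Xh ω) (X ω) (ξ ω)) :=
  ((((isLinearMap_cD g t).measurable.comp hX).add (Finset.measurable_sum _ fun n _ =>
    (isLinearMap_cGp g t n).measurable.comp
      (((a n t).isLinear.measurable.comp hXh).add_const _))).add_const _).add hξ

theorem measurable_stepRHS {Λ : Type*} [MeasurableSpace Λ] {t : ℕ} {Xh X W : Λ → g.State}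
    {y : Λ → g.Y} (hXh : Measurable Xh) (hX : Measurable X) (hy : Measurable y)
    (hW : Measurable W) :
    Measurable (fun ω => stepRHS μ P a b t (Xh ω) (X ω) (y ω) (W ω)) :=
  (((((isLinearMap_cA g t).measurable.comp hX).add (Finset.measurable_sum _ fun n _ =>
    (isLinearMap_cGX g t n).measurable.comp
      (((a n t).isLinear.measurable.comp hXh).add_const _))).add_const _).add
        ((isLinearMap_cC g t).measurable.comp hy)).add hW

theorem memLp_outputRHS [IsFiniteMeasure μ] {t : ℕ} {Xh X : Ω → g.State}
    {ξ : Ω → g.Y} (hXh : MemLp Xh 2 μ) (hX : MemLp X 2 μ) (hξ : MemLp ξ 2 μ) :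
    MemLp (fun ω => outputRHS μ P a b t (Xh ω) (X ω) (ξ ω)) 2 μ :=
  ((((isLinearMap_cD g t).memLp hX).add (memLp_finsetSum _ fun n _ =>
    (isLinearMap_cGp g t n).memLp
      (((a n t).isLinear.memLp hXh).add (memLp_const _)))).add (memLp_const _)).add hξ

theorem memLp_stepRHS [IsFiniteMeasure μ] {t : ℕ} {Xh X W : Ω → g.State}
    {y : Ω → g.Y} (hXh : MemLp Xh 2 μ) (hX : MemLp X 2 μ) (hy : MemLp y 2 μ) (hW : MemLp W 2 μ) :
    MemLp (fun ω => stepRHS μ P a b t (Xh ω) (X ω) (y ω) (W ω)) 2 μ :=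
  (((((isLinearMap_cA g t).memLp hX).add (memLp_finsetSum _ fun n _ =>
    (isLinearMap_cGX g t n).memLp
      (((a n t).isLinear.memLp hXh).add (memLp_const _)))).add (memLp_const _)).add
        ((isLinearMap_cC g t).memLp hy)).add hW

variable (μ P a b) in
/-- Recursive construction of the replica environment: the state at time `t` together with the
outputs before time `t`. -/
def replicaRec : ℕ → (Ω → g.State) × (ℕ → Ω → g.Y)
  | 0 => (P.X0, fun _ _ => 0)
  | t + 1 =>
    let q := replicaRec t
    let Xh := μ[q.1 | MeasurableSpace.comap (past q.2 t) inferInstance]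
    let y := fun ω => outputRHS μ P a b t (Xh ω) (q.1 ω) (P.ξ t ω)
    (fun ω => stepRHS μ P a b t (Xh ω) (q.1 ω) (y ω) (P.W t ω), Function.update q.2 t y)

variable (μ P a b) in
/-- The states of the replica environment. -/
def replicaX (t : ℕ) : Ω → g.State := (replicaRec μ P a b t).1

variable (μ P a b) in
/-- The outputs of the replica environment. -/
def replicaY (t : ℕ) : Ω → g.Y := (replicaRec μ P a b (t + 1)).2 t

theorem replicaRec_snd {t k : ℕ} (h : k < t) :
    (replicaRec μ P a b t).2 k = replicaY μ P a b k := by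
  induction t with
  | zero => lia
  | succ t ih =>
    rcases (Nat.lt_succ_iff.1 h).eq_or_lt with rfl | hlt
    · rfl
    · rw [← ih hlt, replicaRec]
      exact Function.update_of_ne hlt.ne _ _

theorem past_replicaRec (t : ℕ) :
    past (replicaRec μ P a b t).2 t = past (replicaY μ P a b) t := by
  funext ω k
  simp only [past, replicaRec_snd k.2]

theorem condMean_replica (t : ℕ) :
    condMean μ (replicaX μ P a b) (replicaY μ P a b) t
      = μ[(replicaRec μ P a b t).1 |
        MeasurableSpace.comap (past (replicaRec μ P a b t).2 t) inferInstance] := by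
  rw [past_replicaRec]
  rfl

theorem replicaY_eq (t : ℕ) (ω : Ω) :
    replicaY μ P a b t ω = outputRHS μ P a b t
      (condMean μ (replicaX μ P a b) (replicaY μ P a b) t ω) (replicaX μ P a b t ω)
      (P.ξ t ω) := by
  rw [condMean_replica, replicaY, replicaRec]
  simp only [Function.update_self, replicaX]

theorem replicaX_succ (t : ℕ) (ω : Ω) :
    replicaX μ P a b (t + 1) ω = stepRHS μ P a b t
      (condMean μ (replicaX μ P a b) (replicaY μ P a b) t ω) (replicaX μ P a b t ω)
      (replicaY μ P a b t ω) (P.W t ω) := by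
  rw [replicaY_eq, condMean_replica]
  rfl

theorem measurable_past {y : ℕ → Ω → g.Y} {t : ℕ} (hy : ∀ k, k < t → Measurable (y k)) :
    Measurable (past y t) :=
  measurable_pi_lambda _ fun k => hy k k.2

theorem measurable_condMean {X : ℕ → Ω → g.State} {y : ℕ → Ω → g.Y} {t : ℕ}
    (hy : ∀ k, k < t → Measurable (y k)) : Measurable (condMean μ X y t) :=
  (stronglyMeasurable_condExp.mono (measurable_past hy).comap_le).measurable

theorem measurable_replica (h : IndepSecondMoments μ P) {t : ℕ} (ht : t ≤ g.T) :
    Measurable (replicaX μ P a b t) ∧ ∀ k, k < t → Measurable (replicaY μ P a b k) := by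
  induction t with
  | zero => exact ⟨h.meas_X0, fun k hk => by lia⟩
  | succ t ih =>
    obtain ⟨hX, hY⟩ := ih (by lia)
    have hm : Measurable (condMean μ (replicaX μ P a b) (replicaY μ P a b) t) :=
      measurable_condMean hY
    have hy : Measurable (replicaY μ P a b t) := by
      rw [funext (replicaY_eq t)]
      exact measurable_outputRHS hm hX (h.meas_ξ t ht)
    refine ⟨?_, fun k hk => ?_⟩
    · rw [funext (replicaX_succ t)]
      exact measurable_stepRHS hm hX hy (h.meas_W t ht)
    · rcases (Nat.lt_succ_iff.1 hk).eq_or_lt with rfl | hlt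
      exacts [hy, hY k hlt]

theorem isReplica_replica (h : IndepSecondMoments μ P) :
    IsReplica μ P a b (replicaX μ P a b) (replicaY μ P a b) where
  meas_X _ ht := (measurable_replica h ht).1
  meas_y := (measurable_replica h le_rfl).2
  init := rfl
  output t _ := .of_forall fun ω => replicaY_eq t ω
  step t _ := .of_forall fun ω => replicaX_succ t ω

/-- Doob–Dynkin factorization of a function measurable with respect to the past outputs. -/
theorem exists_isEstimator (X : ℕ → Ω → g.State) (y : ℕ → Ω → g.Y) :
    ∃ est, IsEstimator μ X y est := by
  have h : ∀ t, ∃ e : (Fin t → g.Y) → g.State, StronglyMeasurable e ∧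
      condMean μ X y t = e ∘ past y t :=
    fun t => (stronglyMeasurable_condExp (m := MeasurableSpace.comap (past y t) inferInstance)
      (f := X t) (μ := μ)).exists_eq_measurable_comp
  choose est hm he using h
  exact ⟨est, fun t _ => ⟨(hm t).measurable, .of_forall fun ω => (congrFun (he t) ω).symm⟩⟩

variable {Xbar : ℕ → Ω → g.State} {ybar : ℕ → Ω → g.Y}

/-- Forward in time: conditional expectation preserves L², and the equations are affine. -/
theorem IsReplica.memLp [IsProbabilityMeasure μ] (h : IndepSecondMoments μ P)
    (hr : IsReplica μ P a b Xbar ybar) :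
    (∀ t, t ≤ g.T → MemLp (Xbar t) 2 μ) ∧ ∀ t, t < g.T → MemLp (ybar t) 2 μ := by
  have hy : ∀ t, t < g.T → MemLp (Xbar t) 2 μ → MemLp (ybar t) 2 μ := fun t ht hX =>
    (memLp_congr_ae (hr.output t ht)).2
      (memLp_outputRHS (hX.condExp one_le_two) hX (h.memLp_ξ t ht))
  have hX : ∀ t, t ≤ g.T → MemLp (Xbar t) 2 μ := by
    intro t
    induction t with
    | zero => exact fun _ => hr.init ▸ h.memLp_X0
    | succ t ih =>
      intro ht
      have hX := ih (by lia)
      exact (memLp_congr_ae (hr.step t ht)).2 (memLp_stepRHS (hX.condExp one_le_two) hX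
        (hy t ht hX) (h.memLp_W t ht))
  exact ⟨hX, fun t ht => hy t ht (hX t ht.le)⟩

end Replica

/-! ### The actual closed loop and its coincidence with the replica. -/

section JointHistory

variable (s : g.Joint) (X0 : g.State) (W : ℕ → g.State) (ξ : ℕ → g.Y)

/-- The system state at time `t` under the joint strategy `s`. -/
def jointStateAt (t : ℕ) : g.State := (jointHist s X0 W ξ t).1 (Fin.last t)

/-- The environment variable at time `t` under the joint strategy `s`. -/
def jointOutAt (t : ℕ) : g.Y := (jointHist s X0 W ξ (t + 1)).2.2 (Fin.last t)

theorem jointHist_out (t : ℕ) (k : Fin t) :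
    (jointHist s X0 W ξ t).2.2 k = jointOutAt s X0 W ξ k := by
  induction t with
  | zero => exact k.elim0
  | succ t ih =>
    refine Fin.lastCases rfl (fun j => ?_) k
    rw [jointHist]
    simp only [Fin.snoc_castSucc, ih, Fin.val_castSucc]

variable {s W ξ} in
theorem jointHist_congr {W' : ℕ → g.State} {ξ' : ℕ → g.Y} {t : ℕ}
    (hW : ∀ k, k < t → W k = W' k) (hξ : ∀ k, k < t → ξ k = ξ' k) :
    jointHist s X0 W ξ t = jointHist s X0 W' ξ' t := by
  induction t with
  | zero => rfl
  | succ t ih =>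
    simp only [jointHist]
    rw [ih (fun k hk => hW k (by lia)) (fun k hk => hξ k (by lia)), hW t (by lia), hξ t (by lia)]

theorem measurable_jointHist {Λ : Type*} [MeasurableSpace Λ] {s : g.Joint}
    {X0 : Λ → g.State} {W : ℕ → Λ → g.State} {ξ : ℕ → Λ → g.Y}
    (hs : ∀ i, (g.player i).IsPure (s i)) (hX0 : Measurable X0)
    (hW : ∀ t, t < g.T → Measurable (W t)) (hξ : ∀ t, t < g.T → Measurable (ξ t))
    {t : ℕ} (ht : t ≤ g.T) :
    Measurable (fun ω => jointHist s (X0 ω) (fun k => W k ω) (fun k => ξ k ω) t) := by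
  induction t with
  | zero =>
    exact (measurable_pi_lambda _ fun _ => hX0).prodMk (measurable_const.prodMk measurable_const)
  | succ t ih =>
    have ih := ih (by lia)
    set h := fun ω => jointHist s (X0 ω) (fun k => W k ω) (fun k => ξ k ω) t with hh
    have hst : ∀ k i, Measurable fun ω => ((h ω).1 k).2 i := fun k i =>
      (measurable_pi_apply i).comp ((measurable_pi_apply k).comp ih.fst).snd
    have hX0t : Measurable fun ω => ((h ω).1 (Fin.last t)).1 :=
      ((measurable_pi_apply _).comp ih.fst).fst
    have hu : ∀ i, Measurable fun ω =>
        s i t ((fun k => ((h ω).1 k).2 i, fun k => (h ω).2.1 k i), (h ω).2.2) := fun i =>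
      (hs i t ht).comp (((measurable_pi_lambda _ fun k => hst k i).prodMk
        (measurable_pi_lambda _ fun k => (measurable_pi_apply i).comp
          ((measurable_pi_apply k).comp ih.snd.fst))).prodMk ih.snd.snd)
    have mv : ∀ {m n : ℕ} (A : Matrix (Fin m) (Fin n) ℝ) {f : Λ → RVec n}, Measurable f →
        Measurable fun ω => A *ᵥ f ω := fun A _ hf => (measurable_mulVec A).comp hf
    have hy : Measurable fun ω => g.D t *ᵥ ((h ω).1 (Fin.last t)).1 + ∑ i, (g.E1 t i *ᵥ
        s i t ((fun k => ((h ω).1 k).2 i, fun k => (h ω).2.1 k i), (h ω).2.2)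
        + g.E2 t i *ᵥ ((h ω).1 (Fin.last t)).2 i) + ξ t ω :=
      ((mv _ hX0t).add (Finset.measurable_sum _ fun i _ =>
        (mv _ (hu i)).add (mv _ (hst _ i)))).add (hξ t ht)
    have hX' := ((mv (g.A0 t) hX0t).add (Finset.measurable_sum Finset.univ fun i _ =>
        (mv (g.B1 t i) (hu i)).add (mv (g.B2 t i) (hst (Fin.last t) i)))).add (hW t ht).fst
    have hxi := measurable_pi_lambda _ fun i => (((mv ((g.player i).A t) (hst (Fin.last t) i)).add
        (mv ((g.player i).B t) (hu i))).add (mv ((g.player i).C t) hy)).add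
        ((measurable_pi_apply i).comp (hW t ht).snd)
    simp only [jointHist]
    exact (measurable_finSnoc ih.fst (hX'.prodMk hxi)).prodMk
      ((measurable_finSnoc ih.snd.fst (measurable_pi_lambda _ hu)).prodMk
        (measurable_finSnoc ih.snd.snd hy))

end JointHistory

section AffineStrategy

variable {est : ∀ t : ℕ, (Fin t → g.Y) → g.State}

/-- Regrouping exhibits the strategy as certainty equivalent, with `a n t X̂ + b n t` as the
prediction of the output at `n`. -/
theorem affineStrategy_apply (i : Fin g.N) (t : ℕ)
    (info : (g.player i).Info t × (Fin t → g.Y)) :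
    affineStrategy μ P a b est i t info = (g.player i).F t *ᵥ info.1.1 (Fin.last t)
      + (∑ n ∈ Ico t g.T, (g.player i).G t n *ᵥ (a n t (est t info.2) + b n t)
        + Hi μ P i t) := by
  simp only [affineStrategy, gainG, offsetH, LinearMap.sum_apply, LinearMap.comp_apply,
    Matrix.mulVecLin_apply, Matrix.mulVec_add, sum_add_distrib]
  abel

theorem jointOutAt_affineStrategy (X0 : g.State) (W : ℕ → g.State) (ξ : ℕ → g.Y) (t : ℕ) :
    jointOutAt (affineStrategy μ P a b est) X0 W ξ t = outputRHS μ P a b t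
      (est t fun k => jointOutAt (affineStrategy μ P a b est) X0 W ξ k)
      (jointStateAt (affineStrategy μ P a b est) X0 W ξ t) (ξ t) := by
  rw [← funext (jointHist_out (affineStrategy μ P a b est) X0 W ξ t), jointOutAt, jointHist]
  simp only [Fin.snoc_last, affineStrategy_apply]
  simp only [outputRHS, jointStateAt, cD, cGp, cHp, Matrix.mulVec_add, Matrix.mulVec_sum,
    Matrix.mulVec_mulVec, sum_add_distrib]
  -- The closed-loop coefficients sum over players inside the sum over future times; the substituted
  -- strategies sum in the opposite order.
  simp only [sum_comm (s := Ico t g.T) (t := (univ : Finset (Fin g.N)))]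
  abel

theorem jointStateAt_affineStrategy (X0 : g.State) (W : ℕ → g.State) (ξ : ℕ → g.Y) (t : ℕ) :
    jointStateAt (affineStrategy μ P a b est) X0 W ξ (t + 1) = stepRHS μ P a b t
      (est t fun k => jointOutAt (affineStrategy μ P a b est) X0 W ξ k)
      (jointStateAt (affineStrategy μ P a b est) X0 W ξ t)
      (jointOutAt (affineStrategy μ P a b est) X0 W ξ t) (W t) := by
  rw [← funext (jointHist_out (affineStrategy μ P a b est) X0 W ξ t), jointOutAt]
  rw [jointStateAt, jointHist]
  simp only [Fin.snoc_last, affineStrategy_apply, stepRHS, jointStateAt]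
  refine Prod.ext ?_ (funext fun i => ?_)
  · simp only [cA, cGX, cHX, cC, Matrix.mulVec_add, Matrix.mulVec_sum, Prod.fst_add,
      Matrix.mulVec_mulVec, sum_add_distrib, Prod.fst_sum]
    simp only [sum_comm (s := Ico t g.T) (t := (univ : Finset (Fin g.N)))]
    abel
  · simp only [cA, cGX, cHX, cC, Matrix.mulVec_add, Matrix.mulVec_sum, Prod.snd_add,
      Matrix.mulVec_mulVec, sum_add_distrib, Prod.snd_sum, Pi.add_apply, Finset.sum_apply]
    abel

theorem isPure_affineStrategy (hest : ∀ t, t < g.T → Measurable (est t)) (i : Fin g.N) :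
    (g.player i).IsPure (affineStrategy μ P a b est i) := by
  intro t ht
  have h1 : Measurable fun info : (g.player i).Info t × (Fin t → g.Y) =>
      info.1.1 (Fin.last t) := (measurable_pi_apply _).comp measurable_fst.fst
  exact (((measurable_mulVec _).comp h1).add ((gainG a i t).isLinear.measurable.comp
    ((hest t ht).comp measurable_snd))).add_const _

theorem isCertaintyEquivalent_affineStrategy (i : Fin g.N) :
    (g.player i).IsCertaintyEquivalent (fun k => (WHat μ P k).2 i)
      (fun n t v => a n t (est t v) + b n t) (affineStrategy μ P a b est i) :=
  fun t _ info => affineStrategy_apply i t info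

variable {Xbar : ℕ → Ω → g.State} {ybar : ℕ → Ω → g.Y}

/-- Under the affine strategy the system coincides with the replica almost surely. -/
theorem IsReplica.ae_eq_joint (hr : IsReplica μ P a b Xbar ybar)
    (he : IsEstimator μ Xbar ybar est) {t : ℕ} (ht : t ≤ g.T) :
    ∀ᵐ ω ∂μ, Xbar t ω = jointStateAt (affineStrategy μ P a b est) (P.X0 ω) (fun k => P.W k ω)
        (fun k => P.ξ k ω) t ∧
      ∀ k, k < t → ybar k ω = jointOutAt (affineStrategy μ P a b est) (P.X0 ω)
        (fun k => P.W k ω) (fun k => P.ξ k ω) k := by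
  induction t with
  | zero =>
    refine .of_forall fun ω => ⟨?_, fun k hk => by lia⟩
    rw [hr.init]
    rfl
  | succ t ih =>
    filter_upwards [ih (by lia), hr.output t ht, hr.step t ht, (he t ht).2]
      with ω hω hout hstep hest
    -- As the outputs agree so far, the estimator in the actual system returns the conditional mean
    -- of the replica state.
    have hp : past ybar t ω = fun k : Fin t => jointOutAt (affineStrategy μ P a b est) (P.X0 ω)
        (fun k => P.W k ω) (fun k => P.ξ k ω) k := funext fun k => hω.2 k k.2
    have hy : ybar t ω = jointOutAt (affineStrategy μ P a b est) (P.X0 ω)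
        (fun k => P.W k ω) (fun k => P.ξ k ω) t := by
      rw [jointOutAt_affineStrategy, ← hp, hest, ← hω.1, hout]
      rfl
    refine ⟨?_, fun k hk => ?_⟩
    · rw [jointStateAt_affineStrategy, ← hp, hest, ← hω.1, ← hy, hstep]
      rfl
    · rcases (Nat.lt_succ_iff.1 hk).eq_or_lt with rfl | hlt
      exacts [hy, hω.2 k hlt]

theorem IsReplica.envLaw_eq (hr : IsReplica μ P a b Xbar ybar)
    (he : IsEstimator μ Xbar ybar est) :
    envLaw μ P (affineStrategy μ P a b est) = μ.map (past ybar g.T) := by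
  refine Measure.map_congr ?_
  filter_upwards [hr.ae_eq_joint he le_rfl] with ω hω
  funext k
  rw [jointHist_out, ← hω.2 k k.2]
  rfl

end AffineStrategy

end LQGame

/-! ### Independence of the primitives and predictions of the replica outputs. -/

namespace LQGame

section Past

variable {g : LQGame} {Ω : Type*}

/-- The primitives `(X_0, (W_k)_{k < t}, (ξ_k)_{k < t})` before time `t`. -/
def primPast (P : g.Primitives Ω) (t : ℕ) (ω : Ω) :
    g.State × ((Fin t → g.State) × (Fin t → g.Y)) :=
  (P.X0 ω, (fun k => P.W k ω, fun k => P.ξ k ω))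

theorem measurable_primPast_of {m : MeasurableSpace Ω} {P : g.Primitives Ω} {t : ℕ}
    (hX : Measurable P.X0) (hW : ∀ k : Fin t, Measurable (P.W k))
    (hξ : ∀ k : Fin t, Measurable (P.ξ k)) : Measurable (primPast P t) :=
  hX.prodMk ((measurable_pi_lambda _ hW).prodMk (measurable_pi_lambda _ hξ))

theorem envPast_past (y : ℕ → Ω → g.Y) {t : ℕ} (ht : t ≤ g.T) (ω : Ω) :
    LQPlayer.envPast t (past y g.T ω) = past y t ω :=
  funext fun k => extendZero_of_lt _ (k.2.trans_le ht)

end Past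

variable {g : LQGame} {Ω : Type*} [MeasurableSpace Ω] {μ : Measure Ω} {P : g.Primitives Ω}
  {a : ℕ → ℕ → (g.State →ₗ[ℝ] g.Y)} {b : ℕ → ℕ → g.Y}

section Independence

theorem IndepSecondMoments.measurable_primPast (h : IndepSecondMoments μ P) {t : ℕ}
    (ht : t ≤ g.T) : Measurable (primPast P t) :=
  measurable_primPast_of h.meas_X0 (fun k => h.meas_W k (k.2.trans_le ht))
    fun k => h.meas_ξ k (k.2.trans_le ht)

/-- The past primitives are measurable for the σ-algebra generated by all indices other than `j`,
which is independent of that of `j`. -/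
theorem IndepSecondMoments.indep_primPast (h : IndepSecondMoments μ P) {t : ℕ} (ht : t < g.T)
    (j : Unit ⊕ (Fin g.T ⊕ Fin g.T))
    (hj : j = Sum.inr (Sum.inl ⟨t, ht⟩) ∨ j = Sum.inr (Sum.inr ⟨t, ht⟩)) :
    Indep (MeasurableSpace.comap (primPast P t) inferInstance) (primSigma P j) μ := by
  have hle : ∀ j, primSigma P j ≤ ‹MeasurableSpace Ω› := by
    rintro (_ | ⟨k⟩ | ⟨k⟩)
    exacts [h.meas_X0.comap_le, (h.meas_W k k.2).comap_le, (h.meas_ξ k k.2).comap_le]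
  have key := indep_iSup_of_disjoint hle h.indep (disjoint_compl_left (a := ({j} : Set _)))
  refine indep_of_indep_of_le_left (indep_of_indep_of_le_right key ?_) ?_
  · exact le_iSup₂_of_le j rfl le_rfl
  have sub : ∀ k, k ≠ j → primSigma P k ≤ ⨆ i ∈ ({j} : Set _)ᶜ, primSigma P i :=
    fun k hk => le_iSup₂_of_le k hk le_rfl
  have hX : Measurable[⨆ i ∈ ({j} : Set _)ᶜ, primSigma P i] P.X0 :=
    measurable_iff_comap_le.2 (sub (Sum.inl ()) (by rcases hj with rfl | rfl <;> simp))
  have hW : ∀ k : Fin t, Measurable[⨆ i ∈ ({j} : Set _)ᶜ, primSigma P i] (P.W k) := fun k =>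
    measurable_iff_comap_le.2 (sub (Sum.inr (Sum.inl ⟨k, k.2.trans ht⟩))
      (by rcases hj with rfl | rfl <;> simp [k.2.ne]))
  have hξ : ∀ k : Fin t, Measurable[⨆ i ∈ ({j} : Set _)ᶜ, primSigma P i] (P.ξ k) := fun k =>
    measurable_iff_comap_le.2 (sub (Sum.inr (Sum.inr ⟨k, k.2.trans ht⟩))
      (by rcases hj with rfl | rfl <;> simp [k.2.ne]))
  exact measurable_iff_comap_le.1
    (measurable_primPast_of (m := ⨆ i ∈ ({j} : Set _)ᶜ, primSigma P i) hX hW hξ)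

theorem IndepSecondMoments.orthTo_W [IsProbabilityMeasure μ] (h : IndepSecondMoments μ P) {t : ℕ}
    (ht : t < g.T) : OrthTo μ (primPast P t) (fun ω => P.W t ω - WHat μ P t) :=
  .of_indepFun (h.measurable_primPast ht.le) (h.meas_W t ht) (h.memLp_W t ht)
    ((IndepFun_iff_Indep _ _ _).2 (h.indep_primPast ht _ (Or.inl rfl)))

theorem IndepSecondMoments.orthTo_ξ [IsProbabilityMeasure μ] (h : IndepSecondMoments μ P) {t : ℕ}
    (ht : t < g.T) : OrthTo μ (primPast P t) (fun ω => P.ξ t ω - ξHat μ P t) :=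
  .of_indepFun (h.measurable_primPast ht.le) (h.meas_ξ t ht) (h.memLp_ξ t ht)
    ((IndepFun_iff_Indep _ _ _).2 (h.indep_primPast ht _ (Or.inr rfl)))

end Independence

section Prediction

variable {Xbar : ℕ → Ω → g.State} {ybar : ℕ → Ω → g.Y} {est : ∀ t : ℕ, (Fin t → g.Y) → g.State}

/-- Whatever is orthogonal to the past primitives is orthogonal to the past outputs. -/
theorem IsReplica.orthTo_past (hr : IsReplica μ P a b Xbar ybar)
    (he : IsEstimator μ Xbar ybar est) {t : ℕ} (ht : t ≤ g.T) {E : Type*} [NormedAddCommGroup E]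
    [NormedSpace ℝ E] {e : Ω → E} (h : OrthTo μ (primPast P t) e) :
    OrthTo μ (past ybar t) e := by
  -- Past outputs are, almost surely, a measurable function of past primitives: run the closed loop
  -- on these primitives extended by zero.
  have hm : Measurable fun d : g.State × ((Fin t → g.State) × (Fin t → g.Y)) =>
      (jointHist (affineStrategy μ P a b est) d.1 (extendZero d.2.1) (extendZero d.2.2) t).2.2 :=
    (measurable_jointHist (X0 := fun d : g.State × ((Fin t → g.State) × (Fin t → g.Y)) => d.1)
      (W := fun k d => extendZero d.2.1 k) (ξ := fun k d => extendZero d.2.2 k)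
      (isPure_affineStrategy fun t ht => (he t ht).1)
      measurable_fst (fun k _ => (measurable_extendZero k).comp measurable_snd.fst)
      (fun k _ => (measurable_extendZero k).comp measurable_snd.snd) ht).snd.snd
  refine (h.comp hm).congr_left ?_
  filter_upwards [hr.ae_eq_joint he ht] with ω hω
  funext k
  have hc := jointHist_congr (s := affineStrategy μ P a b est) (P.X0 ω)
    (W := extendZero (primPast P t ω).2.1) (W' := fun k => P.W k ω)
    (ξ := extendZero (primPast P t ω).2.2) (ξ' := fun k => P.ξ k ω) (t := t)
    (fun k hk => by rw [extendZero_of_lt _ hk]; rfl)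
    (fun k hk => by rw [extendZero_of_lt _ hk]; rfl)
  change ybar k ω = (jointHist _ (P.X0 ω) _ _ t).2.2 k
  rw [hc, jointHist_out, hω.2 k k.2]

/-- The solution of the prediction equations at the conditional mean of the state predicts the
outputs of the replica. -/
theorem IsReplica.orthTo_prediction [IsProbabilityMeasure μ] (h1 : IndepSecondMoments μ P)
    (h2 : UniquelySolvable μ P) (hab : IsAffineSolution μ P a b)
    (hr : IsReplica μ P a b Xbar ybar) (he : IsEstimator μ Xbar ybar est) {n t : ℕ} (htn : t ≤ n)
    (hn : n < g.T) :
    OrthTo μ (past ybar t) (fun ω => ybar n ω - (a n t (condMean μ Xbar ybar t ω) + b n t)) := by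
  have hX : ∀ t, t < g.T →
      OrthTo μ (past ybar t) (fun ω => Xbar t ω - condMean μ Xbar ybar t ω) := fun t ht =>
    .sub_condExp (measurable_past fun k hk => hr.meas_y k (hk.trans ht)) ((hr.memLp h1).1 t ht.le)
  -- The prediction terms cancel between the replica output and its prediction, leaving the state
  -- estimation error and centred noise.
  have hcur : ∀ t, t < g.T →
      OrthTo μ (past ybar t) (fun ω => ybar t ω - (a t t (condMean μ Xbar ybar t ω) + b t t)) := by
    intro t ht
    refine (((isLinearMap_cD g t).orthTo (hX t ht)).add
      (hr.orthTo_past he ht.le (h1.orthTo_ξ ht))).congr ?_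
    filter_upwards [hr.output t ht] with ω hω
    rw [hω, hab.output ht, (isLinearMap_cD g t).map_sub]
    abel
  induction hm : n - t generalizing t with
  | zero =>
    obtain rfl : t = n := by lia
    exact hcur t hn
  | succ m ih =>
    have ht : t < g.T := by lia
    have down : ∀ {E : Type} [NormedAddCommGroup E] [NormedSpace ℝ E] {e : Ω → E},
        OrthTo μ (past ybar (t + 1)) e → OrthTo μ (past ybar t) e := fun he =>
      he.comp (ρ := fun v k => v (Fin.castSucc k))
        (measurable_pi_lambda _ fun k => measurable_pi_apply _)
    -- This is the error `Xbar (t + 1) - X'` of the state `X'` predicted at time `t`.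
    have hnext := (((isLinearMap_cA g t).orthTo (hX t ht)).add
      ((isLinearMap_cC g t).orthTo (hcur t ht))).add (hr.orthTo_past he ht.le (h1.orthTo_W ht))
    -- By consistency, predicting `ybar n` at `t` means applying the predictor of time `t + 1` to
    -- `X'`. The error is thus that of time `t + 1`, corrected by `a n (t + 1)` applied to `X'`
    -- minus the new conditional mean, itself a difference of two orthogonal errors.
    refine ((down (ih (t := t + 1) (by lia) (by lia))).sub
      ((a n (t + 1)).isLinear.orthTo ((down (hX (t + 1) (by lia))).sub hnext))).congr ?_
    filter_upwards [hr.step t ht] with ω hω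
    obtain ⟨X', hX', hcons⟩ := hab.exists_next h2 ht (condMean μ Xbar ybar t ω)
    have hd : Xbar (t + 1) ω - condMean μ Xbar ybar (t + 1) ω
        - (cA g t (Xbar t ω - condMean μ Xbar ybar t ω)
          + cC g t (ybar t ω - (a t t (condMean μ Xbar ybar t ω) + b t t))
          + (P.W t ω - WHat μ P t)) = X' - condMean μ Xbar ybar (t + 1) ω := by
      rw [hω, hX', (isLinearMap_cA g t).map_sub, (isLinearMap_cC g t).map_sub]
      abel
    rw [hd, hcons n (by lia) hn, map_sub]
    abel

end Prediction

/-! ### Equilibrium with the law of the replica outputs as common belief. -/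

section Equilibrium

variable {Xbar : ℕ → Ω → g.State} {ybar : ℕ → Ω → g.Y} {est : ∀ t : ℕ, (Fin t → g.Y) → g.State}

theorem IsReplica.isSEBEU [IsProbabilityMeasure μ] (h1 : IndepSecondMoments μ P)
    (h2 : UniquelySolvable μ P) (hab : IsAffineSolution μ P a b)
    (hr : IsReplica μ P a b Xbar ybar) (he : IsEstimator μ Xbar ybar est) :
    IsSEBEU μ P (affineStrategy μ P a b est) := by
  have hpast : Measurable (past ybar g.T) := measurable_past hr.meas_y
  have hpure := isPure_affineStrategy (μ := μ) (P := P) (a := a) (b := b)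
    fun t ht => (he t ht).1
  have := Measure.isProbabilityMeasure_map (μ := μ) hpast.aemeasurable
  refine ⟨hpure, fun _ => μ.map (past ybar g.T), fun _ => this, fun i => ?_,
    fun _ => (hr.envLaw_eq he).symm⟩
  have hz : ∀ t, t < g.T →
      MemLp (fun z : Fin g.T → g.Y => extendZero z t) 2 (μ.map (past ybar g.T)) := by
    intro t ht
    refine (memLp_map_measure_iff (measurable_extendZero t).aestronglyMeasurable
      hpast.aemeasurable).2 ?_
    refine (memLp_congr_ae (.of_forall fun ω => ?_)).1 ((hr.memLp h1).2 t ht)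
    rw [Function.comp_apply, extendZero_of_lt _ ht]
    rfl
  -- The prediction property on `Ω` is transported to the belief, with the conditional mean replaced
  -- by the estimator, a function of the output sequence.
  have hzO : ∀ n t, t ≤ n → n < g.T → OrthTo (μ.map (past ybar g.T)) (LQPlayer.envPast t)
      (fun z => extendZero z n - (a n t (est t (LQPlayer.envPast t z)) + b n t)) := by
    intro n t htn hn
    have ht : t < g.T := htn.trans_lt hn
    refine .map hpast (LQPlayer.measurable_envPast t) ?_ ?_
    · exact ((measurable_extendZero n).sub (((a n t).isLinear.measurable.comp
        ((he t ht).1.comp (LQPlayer.measurable_envPast t))).add_const _)).stronglyMeasurable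
    · simp only [envPast_past ybar ht.le]
      refine (hr.orthTo_prediction h1 h2 hab he htn hn).congr ?_
      filter_upwards [(he t ht).2] with ω hω
      rw [hω, extendZero_of_lt _ hn]
      rfl
  have comp : IsLinearMap ℝ (fun X : g.State => X.2 i) := ⟨fun _ _ => rfl, fun _ _ => rfl⟩
  -- A player's own initial state and past noise form a function of all past primitives.
  have hwO : ∀ t, t < g.T → OrthTo μ (fun ω => ((P.X0 ω).2 i, fun k : Fin t => (P.W k ω).2 i))
      (fun ω => (P.W t ω).2 i - (WHat μ P t).2 i) := by
    intro t ht
    refine (comp.orthTo (h1.orthTo_W ht)).comp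
      (ρ := fun d : g.State × ((Fin t → g.State) × (Fin t → g.Y)) =>
        (d.1.2 i, fun k => (d.2.1 k).2 i)) ?_
    exact (comp.measurable.comp measurable_fst).prodMk (measurable_pi_lambda _ fun k =>
      comp.measurable.comp ((measurable_pi_apply k).comp measurable_snd.fst))
  refine isOptimal_of_lintegral_le i (hpure i) h1.meas_X0 h1.meas_W hz fun s' hs' => ?_
  exact (g.player i).lintegral_shiftedCost_le (isCertaintyEquivalent_affineStrategy i) (hpure i)
    hs' (comp.measurable.comp h1.meas_X0) (fun t ht => comp.measurable.comp (h1.meas_W t ht))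
    (comp.memLp h1.memLp_X0) (fun t ht => comp.memLp (h1.memLp_W t ht)) hz hzO hwO

end Equilibrium

end LQGame

end

theorem theorem1 (g : LQGame) {Ω : Type*} [MeasurableSpace Ω] (μ : Measure Ω)
    [IsProbabilityMeasure μ] (P : g.Primitives Ω)
    (h1 : LQGame.IndepSecondMoments μ P) (h2 : LQGame.UniquelySolvable μ P) :
    (∃ a b, LQGame.IsAffineSolution μ P a b) ∧
    ∀ a b, LQGame.IsAffineSolution μ P a b →
      (∃ Xbar ybar est, LQGame.IsReplica μ P a b Xbar ybar ∧
        LQGame.IsEstimator μ Xbar ybar est) ∧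
      ∀ Xbar ybar est, LQGame.IsReplica μ P a b Xbar ybar →
        LQGame.IsEstimator μ Xbar ybar est →
          (∀ t, t ≤ g.T → MemLp (Xbar t) 2 μ) ∧
          (∀ t, t < g.T → MemLp (ybar t) 2 μ) ∧
          LQGame.IsSEBEU μ P (LQGame.affineStrategy μ P a b est) ∧
          LQGame.envLaw μ P (LQGame.affineStrategy μ P a b est)
            = μ.map (LQGame.past ybar g.T) := by
  refine ⟨LQGame.exists_isAffineSolution h2, fun a b hab => ⟨?_, fun Xbar ybar est hr he => ?_⟩⟩
  · obtain ⟨est, he⟩ := LQGame.exists_isEstimator (μ := μ) (LQGame.replicaX μ P a b)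
      (LQGame.replicaY μ P a b)
    exact ⟨_, _, est, LQGame.isReplica_replica h1, he⟩
  · exact ⟨(hr.memLp h1).1, (hr.memLp h1).2, hr.isSEBEU h1 h2 hab he, hr.envLaw_eq he⟩
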